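/- **Setting.** Let $K\ge 1$. A gap matrix is a matrix $\Delta\in[-\tfrac14,\tfrac14]^{K\times K}$ with $\Delta=-\Delta^{T}$; in the environment $\Delta$, a duel $(i,j)$ is won by $i$ with probability $\tfrac12+\Delta_{i,j}$, independently of the past. Let $\mathbb D_{\mathrm{cw}}$ be the set of gap matrices that have a Condorcet winner (CW), i.e. an arm $i^*$ with $\Delta_{i^*,j}>0$ for all $j\ne i^*$. A (possibly randomized) algorithm $A$ chooses, given the past duels and outcomes, either the next pair to duel or to stop and recommend an arm $\hat\imath$; $N$ is the number of duels made (possibly $\infty$), and $\mathbb P_{\Delta,A}$ is the law of the interaction. $A$ is $\delta$-correct if for every $\Delta\in\mathbb D_{\mathrm{cw}}$ it fails to output $i^*(\Delta)$ with $\mathbb P_{\Delta,A}$-probability at most $\delta$. For $i\neq i^*$ let $\Sigma_i^-=\{j:\Delta_{i,j}<0\}$, $K_{i;<0}=|\Sigma_i^-|$, $\|\Delta_i^-\|^2=\sum_{j\in\Sigma_i^-}\Delta_{i,j}^2$, and let $\Delta_{i,(1)}\le\dots\le\Delta_{i,(K_{i;<0})}<0$ be the ordered negative entries of row $i$. Let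 $\tilde\Pi$ be the set of families $\pi=(\pi_i)_{i\ne i^*}$ of bijections $\pi_i:\Sigma_i^-\to\Sigma_i^-$ with $\pi_i(i^*)=i^*$, and let $\Delta^{(\pi)}$ be given by $\Delta^{(\pi)}_{i,j}=\Delta_{i,\pi_i(j)}$ if $\Delta_{i,j}<0$, $\Delta^{(\pi)}_{i,j}=-\Delta_{j,\pi_j(i)}$ if $\Delta_{i,j}>0$, and $\Delta^{(\pi)}_{i,j}=0$ if $\Delta_{i,j}=0$ (these permutations preserve the CW row). **Theorem.** Let $0<\delta\le 1/12$, let $A$ be $\delta$-correct, let $\Delta\in\mathbb D_{\mathrm{cw}}$ with CW $i^*$, and put $$\tilde\chi=\inf\Bigl\{x>0:\ \sup_{\pi\in\tilde\Pi}\mathbb P_{\Delta^{(\pi)},A}(N>x)\le\delta\Bigr\}\in[0,\infty].$$ Then $$\tilde\chi\ \ge\ \frac1{16\log(4/3)}\ \max_{i\ne i^*}\Bigl(\frac1{\Delta_{i^*,i}^2}\wedge\frac{K_{i;<0}}{\|\Delta_i^-\|^2}\Bigr)\ \log\frac1{6\delta},$$ $$\tilde\chi\ \ge\ \frac1{128\log(4/3)}\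 \frac1{\log(2K)}\ \sum_{i\ne i^*}\Bigl(\frac1{\Delta_{i^*,i}^2}\wedge\frac{K_{i;<0}}{\|\Delta_i^-\|^2}\Bigr).$$ **Corollary (local minimax bound with fixed CW row).** Fix a cap $m\in\mathbb N$ (for instance $m=\lfloor K/8\rfloor$). Call an integer vector $s=(s_i)_{i\ne i^*}$ admissible for $\Delta$ if $1\le s_i\le K_{i;<0}\wedge m$ for all $i\neq i^*$, and an effective sparsity of $\Delta$ if it minimizes, over the admissible vectors, $H_{\mathrm{certify}}(s,\delta)+H_{\mathrm{explore}}(s,\delta)$, where $$H_{\mathrm{certify}}(s,\delta)=\sum_{i\ne i^*}\frac{\log(1/\delta)}{\Delta_{i,(s_i)}^2},\qquad H_{\mathrm{explore}}(s,\delta)=\max_{i\ne i^*}\frac{K\log(1/\delta)}{s_i\Delta_{i,(s_i)}^2}+\sum_{i\ne i^*}\frac{K}{s_i\Delta_{i,(s_i)}^2}.$$ For an effective sparsity $s^*$ of $\Delta\in\mathbb D_{\mathrm{cw}}$, let $\mathbb D_0(\Delta)$ be the set of $\tilde\Delta\in\mathbb D_{\mathrm{cw}}$ with the same CW $i^*$,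 for which $s^*$ is also an effective sparsity, and such that $\tilde\Delta_{i,(s_i^*)}=\Delta_{i,(s_i^*)}$ and $\tilde\Delta_{i^*,i}=\Delta_{i^*,i}$ for all $i\neq i^*$. There is a numerical constant $c>0$ such that for all $K$, $m$, all $0<\delta\le1/12$, every $\delta$-correct $A$, every $\Delta\in\mathbb D_{\mathrm{cw}}$ and every effective sparsity $s^*$ of $\Delta$, there is $\tilde\Delta\in\mathbb D_0(\Delta)$ such that, with $\mathbb P_{\tilde\Delta,A}$-probability at least $\delta$, $$N\ \ge\ c\left(\sum_{i\ne i^*}\frac{\log(1/\delta)}{\Delta_{i^*,i}^2\vee\Delta_{i,(s_i^*)}^2}+\max_{i\ne i^*}\frac{\log(1/\delta)}{\Delta_{i^*,i}^2\vee\frac{s_i^*\Delta_{i,(s_i^*)}^2}{K_{i;<0}}}+\frac1{\log(2K)}\sum_{i\ne i^*}\frac{1}{\Delta_{i^*,i}^2\vee\frac{s_i^*\Delta_{i,(s_i^*)}^2}{K_{i;<0}}}\right).$$ (Maxima and sums over the empty set are $0$, which matters only when $K=1$.) -/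

import Mathlib

open scoped ENNReal

namespace Dueling

/-! ### Gap matrices and the Condorcet winner -/

/-- Arm `w` is a Condorcet winner of the gap matrix `Δ`. -/
def IsCW {K : ℕ} (Δ : Matrix (Fin K) (Fin K) ℝ) (w : Fin K) : Prop :=
  ∀ j, j ≠ w → 0 < Δ w j

/-- The class of skew-symmetric gap matrices with entries in `[-1/4, 1/4]` that admit a
Condorcet winner. -/
def Dcw (K : ℕ) : Set (Matrix (Fin K) (Fin K) ℝ) :=
  {Δ | (∀ i j, Δ i j ∈ Set.Icc (-(1 / 4) : ℝ) (1 / 4)) ∧ Δ = -Δ.transpose ∧ ∃ w, IsCW Δ w}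

/-- `K_{i;<0}`: the number of negative entries of row `i`. -/
noncomputable def negCount {K : ℕ} (Δ : Matrix (Fin K) (Fin K) ℝ) (i : Fin K) : ℕ :=
  (Finset.univ.filter fun j => Δ i j < 0).card

/-- `‖Δ_i⁻‖²`, where `Δ⁻_{i,j} = min (Δ_{i,j}, 0)`. -/
noncomputable def negNormSq {K : ℕ} (Δ : Matrix (Fin K) (Fin K) ℝ) (i : Fin K) : ℝ :=
  ∑ j, (min (Δ i j) 0) ^ 2

/-- `Δ_{i,(r)}` for `1 ≤ r ≤ K_{i;<0}`: the `r`-th smallest negative entry of row `i`, counted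
with multiplicity (junk value `0` beyond `K_{i;<0}`). -/
noncomputable def ordGap {K : ℕ} (Δ : Matrix (Fin K) (Fin K) ℝ) (i : Fin K) (r : ℕ) : ℝ :=
  (((Finset.univ.filter fun j => Δ i j < 0).val.map (Δ i)).sort (· ≤ ·)).getD (r - 1) 0

/-! ### Algorithms and their interaction with an environment -/

/-- One round: the ordered pair `(i, j)` that was queried, and the outcome (`true` iff `i` won). -/
abbrev Round (K : ℕ) : Type := (Fin K × Fin K) × Bool

/-- The history of the rounds played so far, most recent round first. -/
abbrev History (K : ℕ) : Type := List (Round K)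

/-- A (possibly randomized) sequential algorithm: given the history, it draws either the next pair
to query (`Sum.inl`), or the decision to stop and recommend an arm (`Sum.inr`). -/
structure Algorithm (K : ℕ) where
  policy : History K → PMF ((Fin K × Fin K) ⊕ Fin K)

/-- The probability `q_{i,j} = 1/2 + Δ_{i,j}` that `i` beats `j`. It is clamped to `[0, 1]`, which
changes nothing when `|Δ_{i,j}| ≤ 1/2`. -/
noncomputable def winProb {K : ℕ} (Δ : Matrix (Fin K) (Fin K) ℝ) (p : Fin K × Fin K) : ℝ :=
  max 0 (min 1 (1 / 2 + Δ p.1 p.2))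

/-- The law of the outcome of a duel: Bernoulli with parameter `q_{i,j}`. -/
noncomputable def outcomeProb {K : ℕ} (Δ : Matrix (Fin K) (Fin K) ℝ) (p : Fin K × Fin K) :
    Bool → ℝ≥0∞
  | true => ENNReal.ofReal (winProb Δ p)
  | false => ENNReal.ofReal (1 - winProb Δ p)

/-- The probability that the interaction of `A` with `Δ` starts with the rounds of the history. -/
noncomputable def reachProb {K : ℕ} (A : Algorithm K) (Δ : Matrix (Fin K) (Fin K) ℝ) :
    History K → ℝ≥0∞
  | [] => 1
  | (p, b) :: h => reachProb A Δ h * (A.policy h (Sum.inl p) * outcomeProb Δ p b)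

/-- Result of a run: `some (h, k)` if the algorithm stops after the history `h` and recommends `k`,
`none` if it never stops. -/
def RunResult (K : ℕ) : Type := Option (History K × Fin K)

/-- Results of runs form a countable set, with the discrete `σ`-algebra. -/
instance (K : ℕ) : MeasurableSpace (RunResult K) := ⊤

/-- The probability that `A` stops exactly after the history `h`, recommending `k`. -/
noncomputable def stopProb {K : ℕ} (A : Algorithm K) (Δ : Matrix (Fin K) (Fin K) ℝ)
    (o : History K × Fin K) : ℝ≥0∞ :=
  reachProb A Δ o.1 * A.policy o.1 (Sum.inr o.2)

/-- The finite set of histories of length `n`. -/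
def histories (K : ℕ) : ℕ → Finset (History K)
  | 0 => {[]}
  | n + 1 => ((Finset.univ : Finset (Round K)) ×ˢ histories K n).image fun x => x.1 :: x.2

theorem mem_histories {K : ℕ} (h : History K) : h ∈ histories K h.length := by
  induction h with
  | nil => simp [histories]
  | cons a t ih => simpa [histories] using ih

theorem length_of_mem_histories {K : ℕ} (n : ℕ) :
    ∀ h ∈ histories K n, h.length = n := by
  induction n with
  | zero => simp [histories]
  | succ n ih =>
    intro h hh
    obtain ⟨x, hx, rfl⟩ := Finset.mem_image.1 hh
    simp [ih x.2 (Finset.mem_product.1 hx).2]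

theorem sum_outcomeProb {K : ℕ} (Δ : Matrix (Fin K) (Fin K) ℝ) (p : Fin K × Fin K) :
    ∑ b, outcomeProb Δ p b = 1 := by
  have h0 : 0 ≤ winProb Δ p := le_max_left _ _
  have h1 : winProb Δ p ≤ 1 := max_le zero_le_one (min_le_left _ _)
  rw [Fintype.sum_bool]
  simp only [outcomeProb]
  rw [← ENNReal.ofReal_add h0 (by linarith)]
  simp

theorem sum_stop_add_reach {K : ℕ} (A : Algorithm K) (Δ : Matrix (Fin K) (Fin K) ℝ) (n : ℕ) :
    (∑ h ∈ histories K n, ∑ k, stopProb A Δ (h, k)) +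
      ∑ h ∈ histories K (n + 1), reachProb A Δ h = ∑ h ∈ histories K n, reachProb A Δ h := by
  have e : ∑ h ∈ histories K (n + 1), reachProb A Δ h =
      ∑ h ∈ histories K n, ∑ p, reachProb A Δ h * A.policy h (Sum.inl p) := by
    rw [histories, Finset.sum_image (by
      rintro ⟨a, t⟩ _ ⟨b, u⟩ _ hab
      simpa using hab), Finset.sum_product_right]
    refine Finset.sum_congr rfl fun h _ => ?_
    rw [Fintype.sum_prod_type]
    refine Finset.sum_congr rfl fun p _ => ?_
    simp only [reachProb]
    rw [← Finset.mul_sum, ← Finset.mul_sum, sum_outcomeProb, mul_one]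
  rw [e, ← Finset.sum_add_distrib]
  refine Finset.sum_congr rfl fun h _ => ?_
  simp only [stopProb]
  rw [← Finset.mul_sum, ← Finset.mul_sum, ← mul_add]
  have := (A.policy h).tsum_coe
  rw [tsum_fintype, Fintype.sum_sum_type, add_comm] at this
  rw [this, mul_one]

theorem sum_stop_add_reach_eq_one {K : ℕ} (A : Algorithm K) (Δ : Matrix (Fin K) (Fin K) ℝ)
    (n : ℕ) :
    (∑ m ∈ Finset.range n, ∑ h ∈ histories K m, ∑ k, stopProb A Δ (h, k)) +
      ∑ h ∈ histories K n, reachProb A Δ h = 1 := by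
  induction n with
  | zero => simp [histories, reachProb]
  | succ n ih => rw [Finset.sum_range_succ, add_assoc, sum_stop_add_reach, ih]

theorem tsum_stopProb_le_one {K : ℕ} (A : Algorithm K) (Δ : Matrix (Fin K) (Fin K) ℝ) :
    ∑' o, stopProb A Δ o ≤ 1 := by
  rw [ENNReal.tsum_eq_iSup_sum]
  refine iSup_le fun s => ?_
  let n := s.sup (fun o => o.1.length) + 1
  refine le_trans ?_ (le_of_le_of_eq le_self_add (sum_stop_add_reach_eq_one A Δ n))
  rw [← Finset.sum_biUnion, ← Finset.sum_product']
  · refine Finset.sum_le_sum_of_subset fun o ho => ?_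
    simp only [Finset.mem_product, Finset.mem_biUnion, Finset.mem_range, Finset.mem_univ,
      and_true]
    exact ⟨o.1.length, Nat.lt_succ_of_le (Finset.le_sup (f := fun o => o.1.length) ho),
      mem_histories _⟩
  · intro a _ b _ hab
    rw [Function.onFun, Finset.disjoint_left]
    intro h ha hb
    exact hab ((length_of_mem_histories a h ha).symm.trans (length_of_mem_histories b h hb))

theorem hasSum_runPMF {K : ℕ} (A : Algorithm K) (Δ : Matrix (Fin K) (Fin K) ℝ) :
    HasSum (fun o : Option (History K × Fin K) =>
      o.elim (1 - ∑' x, stopProb A Δ x) (stopProb A Δ)) 1 := by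
  rw [ENNReal.summable.hasSum_iff]
  rw [ENNReal.tsum_eq_add_tsum_ite none]
  have e := (Option.some_injective (History K × Fin K)).tsum_eq
    (f := fun o => @ite _ (o = none) (Classical.propDecidable _) (0 : ℝ≥0∞)
      (o.elim (1 - ∑' x, stopProb A Δ x) (stopProb A Δ))) (by
    rintro (_ | o) ho
    · simp at ho
    · exact ⟨o, rfl⟩)
  simp only [reduceCtorEq, if_false, Option.elim] at e
  simp only [Option.elim]
  convert tsub_add_cancel_of_le (tsum_stopProb_le_one A Δ) using 2
  rw [e]
  refine tsum_congr fun o => ?_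
  cases o <;> simp

/-- The probability mass function of the result of a run of `A` on the gap matrix `Δ`. The mass of
`none` is the probability that the algorithm never stops. -/
noncomputable def runPMF {K : ℕ} (A : Algorithm K) (Δ : Matrix (Fin K) (Fin K) ℝ) :
    PMF (RunResult K) :=
  ⟨fun o : Option (History K × Fin K) =>
    o.elim (1 - ∑' x, stopProb A Δ x) (stopProb A Δ), hasSum_runPMF A Δ⟩

/-- `ℙ_{Δ,A}`. -/
noncomputable def runLaw {K : ℕ} (A : Algorithm K) (Δ : Matrix (Fin K) (Fin K) ℝ) :
    MeasureTheory.Measure (RunResult K) :=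
  (runPMF A Δ).toMeasure

/-- The budget `N`: the number of duels before stopping, `⊤` if the algorithm never stops. -/
noncomputable def budget {K : ℕ} : RunResult K → EReal
  | none => ⊤
  | some (h, _) => (h.length : EReal)

/-- The recommended arm, `none` if the algorithm never stops. -/
def recommendation {K : ℕ} : RunResult K → Option (Fin K)
  | none => none
  | some (_, k) => some k

/-- `A` is `δ`-correct: on each instance of `Dcw`, it fails to output the Condorcet winner with
probability at most `δ`. -/
def IsDeltaCorrect {K : ℕ} (A : Algorithm K) (δ : ℝ) : Prop :=
  ∀ Δ ∈ Dcw K, ∀ w, IsCW Δ w →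
    runLaw A Δ {o | recommendation o ≠ some w} ≤ ENNReal.ofReal δ

/-! ### Permuted instances and the uniform quantile -/

/-- A family of permutations, one for each row `i`, of the positions of the negative entries of
that row (row `i⋆` has none). -/
abbrev RowPerms {K : ℕ} (Δ : Matrix (Fin K) (Fin K) ℝ) : Type :=
  (i : Fin K) → Equiv.Perm {j : Fin K // Δ i j < 0}

/-- The permutations fix the position `w`. -/
def FixesWinner {K : ℕ} {Δ : Matrix (Fin K) (Fin K) ℝ} (w : Fin K) (π : RowPerms Δ) : Prop :=
  ∀ (i : Fin K) (h : Δ i w < 0), π i ⟨w, h⟩ = ⟨w, h⟩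

open scoped Classical in
/-- `Δ^{(π)}`: the negative entries of each row are permuted, the positive ones follow by
skew-symmetry, and the zero entries are left in place. -/
noncomputable def permuted {K : ℕ} (Δ : Matrix (Fin K) (Fin K) ℝ) (π : RowPerms Δ) :
    Matrix (Fin K) (Fin K) ℝ := fun i j =>
  if h : Δ i j < 0 then Δ i (π i ⟨j, h⟩)
  else if h : Δ j i < 0 then -Δ j (π j ⟨i, h⟩)
  else Δ i j

/-- The uniform `(1 - δ)`-quantile of the budget,
`inf {x > 0 : sup_π ℙ_{Δ^{(π)},A} (N > x) ≤ δ}`, over the families of permutations that fix the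
position of the Condorcet winner `w` (`⊤` if there is no such `x`). -/
noncomputable def chiTilde {K : ℕ} (A : Algorithm K) (Δ : Matrix (Fin K) (Fin K) ℝ) (w : Fin K)
    (δ : ℝ) : EReal :=
  sInf ((fun x : ℝ => (x : EReal)) '' {x : ℝ | 0 < x ∧
    ⨆ π : {π : RowPerms Δ // FixesWinner w π},
      runLaw A (permuted Δ π.1) {o | (x : EReal) < budget o} ≤ ENNReal.ofReal δ})

/-! ### Complexities, effective sparsity, and the local minimax class -/

noncomputable def Hcertify {K : ℕ} (Δ : Matrix (Fin K) (Fin K) ℝ) (w : Fin K) (δ : ℝ)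
    (s : Fin K → ℕ) : ℝ :=
  ∑ i with i ≠ w, Real.log (1 / δ) / (ordGap Δ i (s i)) ^ 2

noncomputable def Hexplore {K : ℕ} (Δ : Matrix (Fin K) (Fin K) ℝ) (w : Fin K) (δ : ℝ)
    (s : Fin K → ℕ) : ℝ :=
  (⨆ i : {i : Fin K // i ≠ w},
      (K : ℝ) * Real.log (1 / δ) / ((s i : ℝ) * (ordGap Δ i (s i)) ^ 2)) +
    ∑ i with i ≠ w, (K : ℝ) / ((s i : ℝ) * (ordGap Δ i (s i)) ^ 2)

/-- Admissible sparsity vectors: `1 ≤ s_i ≤ K_{i;<0} ∧ m` for all `i ≠ w`. The value `s w` is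
never used. -/
def IsAdmissible {K : ℕ} (m : ℕ) (Δ : Matrix (Fin K) (Fin K) ℝ) (w : Fin K)
    (s : Fin K → ℕ) : Prop :=
  ∀ i, i ≠ w → 1 ≤ s i ∧ s i ≤ negCount Δ i ∧ s i ≤ m

/-- `s` is an effective sparsity of `Δ`: a minimizer of `Hcertify + Hexplore` over the
admissible vectors. -/
def IsEffectiveSparsity {K : ℕ} (m : ℕ) (Δ : Matrix (Fin K) (Fin K) ℝ) (w : Fin K) (δ : ℝ)
    (s : Fin K → ℕ) : Prop :=
  IsAdmissible m Δ w s ∧ ∀ s', IsAdmissible m Δ w s' →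
    Hcertify Δ w δ s + Hexplore Δ w δ s ≤ Hcertify Δ w δ s' + Hexplore Δ w δ s'

/-- `𝔻(Δ)`: the instances with the same Condorcet winner `w`, the same effective sparsity `s`, and
the same gaps at the effective sparsity. -/
def classD {K : ℕ} (m : ℕ) (Δ : Matrix (Fin K) (Fin K) ℝ) (w : Fin K) (δ : ℝ)
    (s : Fin K → ℕ) : Set (Matrix (Fin K) (Fin K) ℝ) :=
  {Δ' | Δ' ∈ Dcw K ∧ IsCW Δ' w ∧ IsEffectiveSparsity m Δ' w δ s ∧
    ∀ i, i ≠ w → ordGap Δ' i (s i) = ordGap Δ i (s i)}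

/-- `𝔻₀(Δ)`: the instances of `𝔻(Δ)` that moreover have the same Condorcet winner row. -/
def classD0 {K : ℕ} (m : ℕ) (Δ : Matrix (Fin K) (Fin K) ℝ) (w : Fin K) (δ : ℝ)
    (s : Fin K → ℕ) : Set (Matrix (Fin K) (Fin K) ℝ) :=
  {Δ' | Δ' ∈ classD m Δ w δ s ∧ ∀ i, i ≠ w → Δ' w i = Δ w i}

end Dueling

/-! Everything rests on a change of measure between `Δ` and an alternative in which the winner `w`
is wrong. For `i ≠ w`, `promote Δ i 0` replaces the negative entries of row `i` by `0`. It is a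
limit of instances whose Condorcet winner is `i`, so `A` recommends `w` there with probability at
most `δ`, whereas on `Δ` it does so within `x` duels with probability at least `1 - 2δ` whenever `x`
is an admissible quantile. Only duels that involve `i` and reveal a negative entry of its row tell
the two apart, and each such duel carries information of order the squared gap.

The permutations turn "squared gap" into an average. All instances `Δ^(π)` that differ only in `π i`
have the same alternative (`promote_permuted_update`). Under this common law, the log-likelihood
ratios can be averaged over `π i` round by round: the queried column reveals nothing about the
permutation, so one duel costs a multiple of `rowRate`, the maximum of `Δ_{w,i}²` (the position `w`
is fixed) and of the mean squared negative entry (`sum_sq_permuted_update_le`,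
`average_changeOfMeasure`). To see only the duels of arm `i`, outcomes are switched to the
alternative after the first `n` of them (`truncKernel`); this does not affect the event that `w` is
recommended with at most `n` pulls of `i`.

Taking `n = ⌊x⌋₊` gives the bound for a single row (`row_lower_bound`). Taking `n` of order `1 /
rowRate` shows that, on average over `π`, each arm `i` is pulled that often with probability bounded
below; since a duel involves at most two arms, the sum bound follows (`sum_lower_bound`). The
argument produces no logarithm: `log(2K)` only absorbs a numerical constant. The opposite direction
of the change of measure, without averaging, yields a sum of `log(1/δ)` terms governed by the
largest squared negative entry of each row (`certify_lower_bound`).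

For the corollary, these bounds are applied to a sparsified instance: the winner's entry is kept in
each row, `s_i` top positions are flattened to the threshold `Δ_{i,(s_i)}` (except at `w`), and the
other negative entries are divided by `K`. Gaps only shrink, and those at rank `s_i` are unchanged,
so `s` remains an effective sparsity (`isEffectiveSparsity_of_dominated`). The row rates become
comparable to `Δ_{w,i}² ∨ s_i Δ_{i,(s_i)}² / K_{i;<0}`. All permuted copies stay in the local class,
so one of them has to satisfy the bound. -/

namespace Dueling

section

/-! ### Real-valued description of the interaction with history-dependent outcomes -/

/-- The law of the outcome of a duel, given the history and the pair that was queried. -/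
abbrev OutcomeKernel (K : ℕ) : Type := History K → Fin K × Fin K → Bool → ℝ

/-- The decision probabilities of an algorithm, as real numbers. -/
noncomputable def pol {K : ℕ} (A : Algorithm K) (h : History K)
    (a : (Fin K × Fin K) ⊕ Fin K) : ℝ := (A.policy h a).toReal

/-- The probability of a history when outcomes are drawn from `κ`. -/
noncomputable def reach {K : ℕ} (A : Algorithm K) (κ : OutcomeKernel K) : History K → ℝ
  | [] => 1
  | (p, b) :: h => reach A κ h * (pol A h (Sum.inl p) * κ h p b)

/-- The expectation of `G` at the end of an interaction that is cut after `m` rounds; the second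
argument of `G` is the recommendation if the algorithm has stopped before the cut. -/
noncomputable def leafSum {K : ℕ} (A : Algorithm K) (κ : OutcomeKernel K) (m : ℕ)
    (G : History K → Option (Fin K) → ℝ) : ℝ :=
  (∑ l ∈ Finset.range m, ∑ h ∈ histories K l, ∑ k,
      reach A κ h * pol A h (Sum.inr k) * G h (some k)) +
    ∑ h ∈ histories K m, reach A κ h * G h none

/-- The expectation of `φ` on the event that the algorithm recommends `w` after fewer than `m`
rounds. -/
noncomputable def winMass {K : ℕ} (A : Algorithm K) (κ : OutcomeKernel K) (w : Fin K) (m : ℕ)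
    (φ : History K → ℝ) : ℝ :=
  ∑ l ∈ Finset.range m, ∑ h ∈ histories K l, reach A κ h * pol A h (Sum.inr w) * φ h

/-- The number of rounds of a history that involve arm `i`. -/
def pulls {K : ℕ} (i : Fin K) : History K → ℕ
  | [] => 0
  | (p, _) :: h => pulls i h + if p.1 = i ∨ p.2 = i then 1 else 0

variable {K : ℕ} {A : Algorithm K}

theorem pol_nonneg (h : History K) (a : (Fin K × Fin K) ⊕ Fin K) : 0 ≤ pol A h a :=
  ENNReal.toReal_nonneg

theorem sum_pol (A : Algorithm K) (h : History K) :
    ∑ k, pol A h (Sum.inr k) + ∑ p, pol A h (Sum.inl p) = 1 := by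
  have := (A.policy h).tsum_coe
  rw [tsum_fintype] at this
  have h2 : ∑ a, pol A h a = 1 := by
    unfold pol
    rw [← ENNReal.toReal_sum fun a _ => (A.policy h).apply_ne_top a, this]
    simp
  rw [Fintype.sum_sum_type] at h2
  linarith

theorem sum_histories_succ (m : ℕ) (f : History K → ℝ) :
    ∑ h ∈ histories K (m + 1), f h =
      ∑ h ∈ histories K m, ∑ p, ∑ b, f ((p, b) :: h) := by
  rw [histories, Finset.sum_image (by
    rintro ⟨a, t⟩ _ ⟨b, u⟩ _ hab
    simpa using hab), Finset.sum_product_right]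
  exact Finset.sum_congr rfl fun h _ => Fintype.sum_prod_type _

theorem reach_nonneg {κ : OutcomeKernel K} (h0 : ∀ h p b, 0 ≤ κ h p b) (h : History K) :
    0 ≤ reach A κ h := by
  induction h with
  | nil => simp [reach]
  | cons r h ih =>
    exact mul_nonneg ih (mul_nonneg (pol_nonneg _ _) (h0 _ _ _))

theorem leafSum_mono {κ : OutcomeKernel K} (h0 : ∀ h p b, 0 ≤ κ h p b) (m : ℕ)
    {G G' : History K → Option (Fin K) → ℝ} (hG : ∀ h o, G h o ≤ G' h o) :
    leafSum A κ m G ≤ leafSum A κ m G' := by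
  unfold leafSum
  gcongr with l _ h _ k _ h _
  · exact mul_nonneg (reach_nonneg h0 _) (pol_nonneg _ _)
  · exact hG _ _
  · exact reach_nonneg h0 _
  · exact hG _ _

theorem leafSum_add (A : Algorithm K) (κ : OutcomeKernel K) (m : ℕ)
    (G G' : History K → Option (Fin K) → ℝ) :
    leafSum A κ m (fun h o => G h o + G' h o) = leafSum A κ m G + leafSum A κ m G' := by
  simp only [leafSum, mul_add, Finset.sum_add_distrib]
  ring

theorem leafSum_const_mul (A : Algorithm K) (κ : OutcomeKernel K) (m : ℕ) (c : ℝ)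
    (G : History K → Option (Fin K) → ℝ) :
    leafSum A κ m (fun h o => c * G h o) = c * leafSum A κ m G := by
  simp only [leafSum, mul_add, Finset.mul_sum]
  congr 1
  · refine Finset.sum_congr rfl fun _ _ => Finset.sum_congr rfl fun _ _ =>
      Finset.sum_congr rfl fun _ _ => by ring
  · exact Finset.sum_congr rfl fun _ _ => by ring

theorem leafSum_sum (A : Algorithm K) (κ : OutcomeKernel K) (m : ℕ) {ι : Type*} (T : Finset ι)
    (G : ι → History K → Option (Fin K) → ℝ) :
    leafSum A κ m (fun h o => ∑ t ∈ T, G t h o) = ∑ t ∈ T, leafSum A κ m (G t) := by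
  classical
  induction T using Finset.induction_on with
  | empty => simp [leafSum]
  | insert a T ha ih =>
    simp only [Finset.sum_insert ha]
    rw [leafSum_add, ih]

/-- A function of the history that does not decrease on average in any round does not decrease
on average over the interaction. -/
theorem le_leafSum_of_submartingale {κ : OutcomeKernel K} (h0 : ∀ h p b, 0 ≤ κ h p b)
    {F : History K → ℝ} (hF : ∀ h p, F h ≤ ∑ b, κ h p b * F ((p, b) :: h)) (m : ℕ) :
    F [] ≤ leafSum A κ m (fun h _ => F h) := by
  induction m with
  | zero => simp [leafSum, histories, reach]
  | succ m ih =>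
    refine ih.trans ?_
    unfold leafSum
    rw [Finset.sum_range_succ, add_assoc, add_le_add_iff_left, sum_histories_succ,
      ← Finset.sum_add_distrib]
    refine Finset.sum_le_sum fun h _ => ?_
    calc reach A κ h * F h
        = reach A κ h * ((∑ k, pol A h (Sum.inr k) + ∑ p, pol A h (Sum.inl p)) * F h) := by
          rw [sum_pol, one_mul]
      _ = ∑ k, reach A κ h * pol A h (Sum.inr k) * F h +
            ∑ p, reach A κ h * pol A h (Sum.inl p) * F h := by
          rw [add_mul, mul_add, Finset.sum_mul, Finset.sum_mul, Finset.mul_sum, Finset.mul_sum]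
          simp only [mul_assoc]
      _ ≤ _ := by
          gcongr with p _
          calc reach A κ h * pol A h (Sum.inl p) * F h
              ≤ reach A κ h * pol A h (Sum.inl p) * ∑ b, κ h p b * F ((p, b) :: h) :=
                mul_le_mul_of_nonneg_left (hF h p)
                  (mul_nonneg (reach_nonneg h0 _) (pol_nonneg _ _))
            _ = ∑ b, reach A κ ((p, b) :: h) * F ((p, b) :: h) := by
                rw [Finset.mul_sum]
                exact Finset.sum_congr rfl fun b _ => by simp only [reach]; ring

theorem leafSum_const {κ : OutcomeKernel K} (h0 : ∀ h p b, 0 ≤ κ h p b)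
    (h1 : ∀ h p, ∑ b, κ h p b = 1) (m : ℕ) (c : ℝ) :
    leafSum A κ m (fun _ _ => c) = c := by
  have key : ∀ c : ℝ, c ≤ leafSum A κ m (fun _ _ => c) := fun c =>
    le_leafSum_of_submartingale (F := fun _ => c) h0
      (fun h p => by rw [← Finset.sum_mul, h1, one_mul]) m
  have h2 := leafSum_const_mul A κ m (-1) (fun _ _ => c)
  have h3 := key (-1 * c)
  linarith [key c]

/-- If each round decreases `F` by at most `D` on average, and only the first `n` rounds that
involve arm `i` decrease it at all, then `F` decreases by at most `D * n` on average. -/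
theorem neg_mul_le_leafSum {κ : OutcomeKernel K} (h0 : ∀ h p b, 0 ≤ κ h p b)
    (h1 : ∀ h p, ∑ b, κ h p b = 1) (i : Fin K) (n : ℕ) {D : ℝ} (hD : 0 ≤ D)
    {F : History K → ℝ} (hnil : F [] = 0)
    (hF : ∀ h p, F h - (if (p.1 = i ∨ p.2 = i) ∧ pulls i h < n then D else 0) ≤
      ∑ b, κ h p b * F ((p, b) :: h)) (m : ℕ) :
    -(D * n) ≤ leafSum A κ m (fun h _ => F h) := by
  -- The compensator `D * min (pulls i h) n` grows by `D` exactly in the rounds where `F` may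
  -- decrease, and never exceeds `D * n`.
  have key := le_leafSum_of_submartingale (A := A) (κ := κ)
    (F := fun h => F h + D * (min (pulls i h) n : ℕ)) h0 (by
      intro h p
      have e : ∑ b, κ h p b * (F ((p, b) :: h) + D * (min (pulls i ((p, b) :: h)) n : ℕ)) =
          ∑ b, κ h p b * F ((p, b) :: h) +
            D * (min (pulls i h + if p.1 = i ∨ p.2 = i then 1 else 0) n : ℕ) := by
        simp only [mul_add, Finset.sum_add_distrib, pulls]
        rw [← Finset.sum_mul, h1, one_mul]
      rw [e]
      have := hF h p
      by_cases hp : p.1 = i ∨ p.2 = i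
      · by_cases hn : pulls i h < n
        · have e2 : min (pulls i h + 1) n = min (pulls i h) n + 1 := by omega
          simp only [hp, hn, true_and, if_true, e2] at this ⊢
          push_cast
          linarith
        · have e2 : min (pulls i h + 1) n = min (pulls i h) n := by omega
          simp only [hp, hn, and_false, if_true, if_false, e2] at this ⊢
          linarith
      · simp only [hp, false_and, if_false, add_zero] at this ⊢
        linarith) m
  have e3 := leafSum_add A κ m (fun h _ => F h) (fun h _ => D * (min (pulls i h) n : ℕ))
  have e4 : leafSum A κ m (fun h _ => D * (min (pulls i h) n : ℕ)) ≤ D * n := by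
    refine (leafSum_mono h0 m (G' := fun _ _ => D * n) fun h _ => ?_).trans
      (leafSum_const h0 h1 m _).le
    gcongr
    exact min_le_right _ _
  simp only [hnil, pulls, Nat.zero_min, Nat.cast_zero, mul_zero, add_zero] at key
  linarith

/-- The log-likelihood ratio of a history between two outcome kernels. -/
noncomputable def logRatio (κ κ' : OutcomeKernel K) : History K → ℝ
  | [] => 0
  | (p, b) :: h => logRatio κ κ' h + Real.log (κ h p b / κ' h p b)

theorem reach_eq_mul_exp {κ κ' : OutcomeKernel K} (hκ : ∀ h p b, 0 < κ h p b)
    (hκ' : ∀ h p b, 0 < κ' h p b) (h : History K) :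
    reach A κ h = reach A κ' h * Real.exp (logRatio κ κ' h) := by
  induction h with
  | nil => simp [reach, logRatio]
  | cons r h ih =>
    obtain ⟨p, b⟩ := r
    simp only [reach, logRatio]
    rw [ih, Real.exp_add, Real.exp_log (div_pos (hκ _ _ _) (hκ' _ _ _))]
    have := (hκ' h p b).ne'
    field_simp

/-- The right side is the `κ'`-expectation of `exp (c + logRatio)`; the inequality `1 + x ≤ exp x`
is applied at each leaf. It plays the role of the variational formula for the Kullback–Leibler
divergence, with `c` free. -/
theorem leafSum_le_leafSum_exp {κ κ' : OutcomeKernel K} (hκ : ∀ h p b, 0 < κ h p b)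
    (hκ' : ∀ h p b, 0 < κ' h p b) (m : ℕ) (c : History K → Option (Fin K) → ℝ) :
    leafSum A κ' m (fun h o => 1 + c h o + logRatio κ κ' h) ≤
      leafSum A κ m (fun h o => Real.exp (c h o)) := by
  have key : ∀ h o, reach A κ' h * (1 + c h o + logRatio κ κ' h) ≤
      reach A κ h * Real.exp (c h o) := by
    intro h o
    rw [reach_eq_mul_exp hκ hκ', mul_assoc, ← Real.exp_add]
    refine mul_le_mul_of_nonneg_left ?_ (reach_nonneg (fun h p b => (hκ' h p b).le) _)
    linarith [Real.add_one_le_exp (logRatio κ κ' h + c h o)]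
  unfold leafSum
  refine add_le_add (Finset.sum_le_sum fun l _ => Finset.sum_le_sum fun h _ =>
    Finset.sum_le_sum fun k _ => ?_) (Finset.sum_le_sum fun h _ => key h none)
  have := mul_le_mul_of_nonneg_left (key h (some k)) (pol_nonneg (A := A) h (Sum.inr k))
  linarith

theorem leafSum_ite {κ : OutcomeKernel K} (h0 : ∀ h p b, 0 ≤ κ h p b)
    (h1 : ∀ h p, ∑ b, κ h p b = 1) (m : ℕ) (w : Fin K) (φ : History K → ℝ) (a b : ℝ) :
    leafSum A κ m (fun h o => b + if o = some w then (a - b) * φ h else 0) =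
      b + (a - b) * winMass A κ w m φ := by
  rw [leafSum_add, leafSum_const h0 h1]
  congr 1
  simp only [leafSum, winMass, Finset.mul_sum]
  simp only [reduceCtorEq, if_false, mul_zero, Finset.sum_const_zero, add_zero,
    Option.some_inj, mul_ite]
  refine Finset.sum_congr rfl fun _ _ => Finset.sum_congr rfl fun _ _ => ?_
  rw [Finset.sum_ite_eq' Finset.univ w]
  simp only [Finset.mem_univ, if_true]
  ring

/-- The variational form of the data-processing inequality for the event that the algorithm
recommends `w` in fewer than `m` rounds after a history of `S`. -/
theorem dataProcessing {κ κ' : OutcomeKernel K} (hκ : ∀ h p b, 0 < κ h p b)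
    (hκ' : ∀ h p b, 0 < κ' h p b) (h1 : ∀ h p, ∑ b, κ h p b = 1)
    (h1' : ∀ h p, ∑ b, κ' h p b = 1) (m : ℕ) (w : Fin K) (S : Set (History K)) (c d : ℝ) :
    1 + d + (c - d) * winMass A κ' w m (S.indicator 1) +
        leafSum A κ' m (fun h _ => logRatio κ κ' h) ≤
      Real.exp d + (Real.exp c - Real.exp d) * winMass A κ w m (S.indicator 1) := by
  classical
  have key := leafSum_le_leafSum_exp (A := A) hκ hκ' m
    (fun h o => d + if o = some w then (c - d) * S.indicator 1 h else 0)
  -- The test function takes the value `c` on the event and `d` off it, so its exponential is again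
  -- two-valued.
  have e1 : (fun h (o : Option (Fin K)) =>
      Real.exp (d + if o = some w then (c - d) * S.indicator 1 h else 0)) =
      fun h o => Real.exp d + if o = some w then
        (Real.exp c - Real.exp d) * S.indicator 1 h else 0 := by
    funext h o
    by_cases ho : o = some w <;> by_cases hS : h ∈ S <;> simp [ho, hS]
  rw [e1, leafSum_ite (fun h p b => (hκ h p b).le) h1, leafSum_add, leafSum_add,
    leafSum_const (fun h p b => (hκ' h p b).le) h1',
    leafSum_ite (fun h p b => (hκ' h p b).le) h1'] at key
  linarith

theorem winMass_mono {κ : OutcomeKernel K} (h0 : ∀ h p b, 0 ≤ κ h p b) (w : Fin K) (m : ℕ)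
    {φ ψ : History K → ℝ} (hφ : ∀ l < m, ∀ h ∈ histories K l, φ h ≤ ψ h) :
    winMass A κ w m φ ≤ winMass A κ w m ψ := by
  unfold winMass
  refine Finset.sum_le_sum fun l hl => Finset.sum_le_sum fun h hh =>
    mul_le_mul_of_nonneg_left (hφ l (Finset.mem_range.1 hl) h hh) ?_
  exact mul_nonneg (reach_nonneg h0 _) (pol_nonneg _ _)

theorem winMass_const_mul (A : Algorithm K) (κ : OutcomeKernel K) (w : Fin K) (m : ℕ) (c : ℝ)
    (φ : History K → ℝ) :
    winMass A κ w m (fun h => c * φ h) = c * winMass A κ w m φ := by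
  simp only [winMass, Finset.mul_sum]
  exact Finset.sum_congr rfl fun _ _ => Finset.sum_congr rfl fun _ _ => by ring

theorem winMass_one_le {κ : OutcomeKernel K} (h0 : ∀ h p b, 0 ≤ κ h p b)
    (h1 : ∀ h p, ∑ b, κ h p b = 1) (w : Fin K) (m : ℕ) : winMass A κ w m 1 ≤ 1 := by
  have e := leafSum_ite (A := A) h0 h1 m w 1 1 0
  have := leafSum_mono (A := A) h0 m (G := fun h o => 0 +
    if o = some w then (1 - 0 : ℝ) * (1 : History K → ℝ) h else 0)
    (G' := fun _ _ => (1 : ℝ)) (fun h o => by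
      dsimp only [Pi.one_apply]
      split_ifs <;> norm_num)
  rw [e, leafSum_const h0 h1] at this
  linarith

end

section

/-! ### Environments -/

/-- Skew-symmetric matrices with entries in `[-1/4, 1/4]`. -/
def IsGap {K : ℕ} (M : Matrix (Fin K) (Fin K) ℝ) : Prop :=
  (∀ i j, M i j ∈ Set.Icc (-(1 / 4) : ℝ) (1 / 4)) ∧ ∀ i j, M j i = -M i j

/-- The outcome kernel of a gap matrix. -/
noncomputable def envKernel {K : ℕ} (M : Matrix (Fin K) (Fin K) ℝ) : OutcomeKernel K :=
  fun _ p b => bif b then 1 / 2 + M p.1 p.2 else 1 / 2 - M p.1 p.2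

/-- The matrix obtained from `M` by raising the off-diagonal entries of row `i` to at least `ε`. -/
noncomputable def promote {K : ℕ} (M : Matrix (Fin K) (Fin K) ℝ) (i : Fin K) (ε : ℝ) :
    Matrix (Fin K) (Fin K) ℝ := fun j k =>
  if j = i then (if k = i then 0 else max (M i k) ε)
  else if k = i then -max (M i j) ε else M j k

/-- Outcomes follow `M` in the first `n` rounds that involve arm `i`, and then `M'`. -/
noncomputable def truncKernel {K : ℕ} (M M' : Matrix (Fin K) (Fin K) ℝ) (i : Fin K) (n : ℕ) :
    OutcomeKernel K :=
  fun h p b => if pulls i h < n then envKernel M h p b else envKernel M' h p b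

variable {K : ℕ} {A : Algorithm K} {M M' : Matrix (Fin K) (Fin K) ℝ} {δ : ℝ}

theorem isGap_of_mem_Dcw (hM : M ∈ Dcw K) : IsGap M := by
  refine ⟨hM.1, fun i j => ?_⟩
  conv_lhs => rw [hM.2.1]
  simp

theorem mem_Dcw_of_isGap (hM : IsGap M) {w : Fin K} (hw : IsCW M w) : M ∈ Dcw K := by
  refine ⟨hM.1, ?_, w, hw⟩
  ext i j
  simp [hM.2 i j]

theorem IsGap.diag (hM : IsGap M) (i : Fin K) : M i i = 0 := by
  linarith [hM.2 i i]

theorem sum_envKernel (M : Matrix (Fin K) (Fin K) ℝ) (h : History K) (p : Fin K × Fin K) :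
    ∑ b, envKernel M h p b = 1 := by
  simp only [Fintype.sum_bool, envKernel, cond_true, cond_false]
  ring

theorem envKernel_pos (hM : IsGap M) (h : History K) (p : Fin K × Fin K) (b : Bool) :
    0 < envKernel M h p b := by
  have := hM.1 p.1 p.2
  rw [Set.mem_Icc] at this
  cases b <;> simp only [envKernel, cond_true, cond_false] <;> linarith

theorem sum_truncKernel (M M' : Matrix (Fin K) (Fin K) ℝ) (i : Fin K) (n : ℕ) (h : History K)
    (p : Fin K × Fin K) : ∑ b, truncKernel M M' i n h p b = 1 := by
  unfold truncKernel
  split_ifs <;> exact sum_envKernel _ _ _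

theorem truncKernel_pos (hM : IsGap M) (hM' : IsGap M') (i : Fin K) (n : ℕ) (h : History K)
    (p : Fin K × Fin K) (b : Bool) : 0 < truncKernel M M' i n h p b := by
  unfold truncKernel
  split_ifs <;> exact envKernel_pos ‹_› _ _ _

/-! ### From the law of a run to finite sums over histories; consequences of `δ`-correctness. -/

theorem toReal_reachProb (A : Algorithm K) (hM : IsGap M) (h : History K) :
    (reachProb A M h).toReal = reach A (envKernel M) h := by
  induction h with
  | nil => simp [reachProb, reach]
  | cons r h ih =>
    obtain ⟨p, b⟩ := r
    have := hM.1 p.1 p.2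
    rw [Set.mem_Icc] at this
    have e : winProb M p = 1 / 2 + M p.1 p.2 := by
      rw [winProb, min_eq_right (by linarith), max_eq_right (by linarith)]
    simp only [reachProb, reach, ENNReal.toReal_mul, ih, pol]
    cases b
    · simp only [outcomeProb, envKernel, cond_false, e]
      rw [ENNReal.toReal_ofReal (by linarith)]
      ring
    · simp only [outcomeProb, envKernel, cond_true, e]
      rw [ENNReal.toReal_ofReal (by linarith)]

/-- The event that the algorithm recommends `w` in fewer than `m` rounds. -/
def winEvent {K : ℕ} (w : Fin K) (m : ℕ) : Set (RunResult K) :=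
  {o | ∃ h : History K, o = some (h, w) ∧ h.length < m}

theorem toReal_runLaw_winEvent (A : Algorithm K) (hM : IsGap M) (w : Fin K) (m : ℕ) :
    (runLaw A M (winEvent w m)).toReal = winMass A (envKernel M) w m 1 := by
  classical
  let F : Finset (RunResult K) :=
    ((Finset.range m).biUnion (histories K)).image fun h => some (h, w)
  have hF : winEvent w m = (F : Set (RunResult K)) := by
    ext o
    refine Iff.trans ?_ (Finset.mem_coe.trans Finset.mem_image).symm
    constructor
    · rintro ⟨h, rfl, hh⟩
      exact ⟨h, Finset.mem_biUnion.2 ⟨_, Finset.mem_range.2 hh, mem_histories h⟩, rfl⟩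
    · rintro ⟨h, hh, rfl⟩
      obtain ⟨l, hl, hh⟩ := Finset.mem_biUnion.1 hh
      refine ⟨h, rfl, ?_⟩
      rw [length_of_mem_histories l h hh]
      exact Finset.mem_range.1 hl
  have hinj : Function.Injective fun h : History K => (some (h, w) : Option (History K × Fin K)) :=
    fun a b hab => by simpa using hab
  have : MeasurableSingletonClass (RunResult K) := ⟨fun _ => trivial⟩
  have e1 : runLaw A M (winEvent w m) =
      ∑ h ∈ (Finset.range m).biUnion (histories K), stopProb A M (h, w) := by
    rw [hF, runLaw, PMF.toMeasure_apply_finset]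
    exact Finset.sum_image fun a _ b _ hab => hinj hab
  have hfin : ∀ h ∈ (Finset.range m).biUnion (histories K), stopProb A M (h, w) ≠ ∞ :=
    fun h _ => ((ENNReal.le_tsum (h, w)).trans (tsum_stopProb_le_one A M)).trans_lt
      ENNReal.one_lt_top |>.ne
  rw [e1, ENNReal.toReal_sum hfin, Finset.sum_biUnion, winMass]
  · refine Finset.sum_congr rfl fun l _ => Finset.sum_congr rfl fun h _ => ?_
    rw [stopProb, ENNReal.toReal_mul, toReal_reachProb A hM]
    simp [pol]
  · intro a _ b _ hab
    rw [Function.onFun, Finset.disjoint_left]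
    intro h ha hb
    exact hab ((length_of_mem_histories a h ha).symm.trans (length_of_mem_histories b h hb))

instance (A : Algorithm K) (M : Matrix (Fin K) (Fin K) ℝ) :
    MeasureTheory.IsProbabilityMeasure (runLaw A M) :=
  PMF.toMeasure.isProbabilityMeasure _

theorem winMass_le_of_isDeltaCorrect (hδ : 0 ≤ δ) (hA : IsDeltaCorrect A δ) (hM : IsGap M)
    {i w : Fin K} (hi : IsCW M i) (hw : w ≠ i) (m : ℕ) :
    winMass A (envKernel M) w m 1 ≤ δ := by
  rw [← toReal_runLaw_winEvent A hM]
  refine ENNReal.toReal_le_of_le_ofReal hδ ((MeasureTheory.measure_mono ?_).trans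
    (hA M (mem_Dcw_of_isGap hM hi) i hi))
  rintro _ ⟨h, rfl, -⟩
  change some w ≠ some i
  simpa using hw

/-- A run that is not counted either errs or has `N > x`, each with probability at most `δ`. The cut
is `⌊x⌋₊ + 1` because `winMass` counts lengths strictly below it. -/
theorem le_winMass_of_isDeltaCorrect (hδ : 0 ≤ δ) (hA : IsDeltaCorrect A δ) (hM : IsGap M)
    {w : Fin K} (hw : IsCW M w) {x : ℝ} (hx : 0 ≤ x)
    (hN : runLaw A M {o | (x : EReal) < budget o} ≤ ENNReal.ofReal δ) :
    1 - 2 * δ ≤ winMass A (envKernel M) w (⌊x⌋₊ + 1) 1 := by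
  rw [← toReal_runLaw_winEvent A hM]
  have hcover : (Set.univ : Set (RunResult K)) ⊆ (winEvent w (⌊x⌋₊ + 1) ∪
      {o | recommendation o ≠ some w}) ∪ {o | (x : EReal) < budget o} := by
    rintro (_ | ⟨h, k⟩) -
    · exact Or.inl (Or.inr (show none ≠ some w by simp))
    · by_cases hk : k = w
      · subst hk
        by_cases hh : h.length < ⌊x⌋₊ + 1
        · exact Or.inl (Or.inl ⟨h, rfl, hh⟩)
        · refine Or.inr ?_
          have h2 : x < h.length := (Nat.floor_lt hx).1 (by omega)
          change (x : EReal) < ((h.length : ℕ) : EReal)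
          exact_mod_cast h2
      · exact Or.inl (Or.inr (show some k ≠ some w by simpa using hk))
  have h1 : (1 : ℝ≥0∞) ≤ runLaw A M (winEvent w (⌊x⌋₊ + 1)) + ENNReal.ofReal δ +
      ENNReal.ofReal δ := by
    rw [← MeasureTheory.measure_univ (μ := runLaw A M)]
    refine (MeasureTheory.measure_mono hcover).trans ((MeasureTheory.measure_union_le _ _).trans ?_)
    refine add_le_add ((MeasureTheory.measure_union_le _ _).trans ?_) hN
    exact add_le_add le_rfl (hA M (mem_Dcw_of_isGap hM hw) w hw)
  have hfin : runLaw A M (winEvent w (⌊x⌋₊ + 1)) ≠ ∞ := MeasureTheory.measure_ne_top _ _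
  have h2 := ENNReal.toReal_mono (by simp [hfin]) h1
  rw [ENNReal.toReal_add (by simp [hfin]) (by simp), ENNReal.toReal_add hfin (by simp),
    ENNReal.toReal_ofReal hδ, ENNReal.toReal_one] at h2
  linarith

/-! ### The alternative environments and the truncated kernel. -/

theorem isGap_promote (hM : IsGap M) (i : Fin K) {ε : ℝ} (h0 : 0 ≤ ε) (h1 : ε ≤ 1 / 4) :
    IsGap (promote M i ε) := by
  have hmax : ∀ j, max (M i j) ε ∈ Set.Icc (0 : ℝ) (1 / 4) := fun j =>
    ⟨le_max_of_le_right h0, max_le (hM.1 i j).2 h1⟩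
  constructor
  · intro j k
    unfold promote
    split_ifs with h2 h3 h4
    · norm_num
    · exact ⟨by linarith [(hmax k).1], (hmax k).2⟩
    · exact ⟨by linarith [(hmax j).2], by linarith [(hmax j).1]⟩
    · exact hM.1 j k
  · intro j k
    unfold promote
    by_cases h2 : j = i <;> by_cases h3 : k = i <;> simp [h2, h3, hM.2 j k]

theorem isCW_promote (M : Matrix (Fin K) (Fin K) ℝ) (i : Fin K) {ε : ℝ} (h0 : 0 < ε) :
    IsCW (promote M i ε) i := by
  intro j hj
  simp only [promote, if_true, hj, if_false]
  exact lt_max_of_lt_right h0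

theorem continuous_winMass_promote (A : Algorithm K) (M : Matrix (Fin K) (Fin K) ℝ) (i w : Fin K)
    (m : ℕ) (φ : History K → ℝ) :
    Continuous fun ε : ℝ => winMass A (envKernel (promote M i ε)) w m φ := by
  have h1 : ∀ j k, Continuous fun ε : ℝ => promote M i ε j k := by
    intro j k
    unfold promote
    split_ifs <;> fun_prop
  have h2 : ∀ h, Continuous fun ε : ℝ => reach A (envKernel (promote M i ε)) h := by
    intro h
    induction h with
    | nil => simpa [reach] using continuous_const
    | cons r h ih =>
      obtain ⟨p, b⟩ := r
      have := h1 p.1 p.2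
      cases b <;> simp only [reach, envKernel, cond_true, cond_false] <;> fun_prop
  unfold winMass
  fun_prop

/-- At `ε = 0` arm `i` need not be a Condorcet winner, so `δ`-correctness does not apply directly.
It applies for `0 < ε ≤ 1/4`, and `winMass`, a finite sum because of the cut `m`, is continuous in
`ε`. -/
theorem winMass_promote_le (hδ : 0 ≤ δ) (hA : IsDeltaCorrect A δ) (hM : IsGap M)
    {i w : Fin K} (hw : w ≠ i) (m : ℕ) (S : Set (History K)) :
    winMass A (envKernel (promote M i 0)) w m (S.indicator 1) ≤ δ := by
  have hlim := (continuous_winMass_promote A M i w m (S.indicator 1)).tendsto 0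
  refine le_of_tendsto (hlim.mono_left (nhdsWithin_le_nhds (s := Set.Ioi 0))) ?_
  filter_upwards [Ioc_mem_nhdsGT (show (0 : ℝ) < 1 / 4 by norm_num)] with ε hε
  have hg := isGap_promote hM i hε.1.le hε.2
  refine (winMass_mono (fun h p b => (envKernel_pos hg h p b).le) w m fun _ _ h _ => ?_).trans
    (winMass_le_of_isDeltaCorrect hδ hA hg (isCW_promote M i hε.1) hw m)
  exact Set.indicator_le_self' (fun _ _ => zero_le_one) h

/-- If a history has at most `n` pulls of `i`, each of its rounds with `i` was played while the
count was below `n`, hence under `M`; in the other rounds `M` and `M'` agree. -/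
theorem winMass_truncKernel (A : Algorithm K) {i : Fin K}
    (hMM' : ∀ j k, j ≠ i → k ≠ i → M' j k = M j k) (w : Fin K) (n m : ℕ) :
    winMass A (truncKernel M M' i n) w m ({h | pulls i h ≤ n}.indicator 1) =
      winMass A (envKernel M) w m ({h | pulls i h ≤ n}.indicator 1) := by
  have key : ∀ h : History K, pulls i h ≤ n →
      reach A (truncKernel M M' i n) h = reach A (envKernel M) h := by
    intro h
    induction h with
    | nil => intro _; rfl
    | cons r h ih =>
      obtain ⟨p, b⟩ := r
      intro hn
      simp only [pulls] at hn
      simp only [reach]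
      rw [ih (by omega)]
      congr 2
      unfold truncKernel
      split_ifs with h2
      · rfl
      · have hp : ¬(p.1 = i ∨ p.2 = i) := by
          intro hp
          simp only [hp, if_true] at hn
          omega
        push Not at hp
        simp only [envKernel, hMM' _ _ hp.1 hp.2]
  unfold winMass
  refine Finset.sum_congr rfl fun _ _ => Finset.sum_congr rfl fun h _ => ?_
  by_cases hh : pulls i h ≤ n
  · rw [key h hh]
  · simp [hh]

end

section

/-! ### Information costs -/

/-- The squared negative gap of row `i` that is revealed by the pair `p`. -/
noncomputable def rowCost {K : ℕ} (M : Matrix (Fin K) (Fin K) ℝ) (i : Fin K)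
    (p : Fin K × Fin K) : ℝ :=
  if p.1 = i then (min (M i p.2) 0) ^ 2 else if p.2 = i then (min (M i p.1) 0) ^ 2 else 0

variable {K : ℕ} {A : Algorithm K} {M M' : Matrix (Fin K) (Fin K) ℝ} {δ : ℝ}

theorem rowCost_nonneg (M : Matrix (Fin K) (Fin K) ℝ) (i : Fin K) (p : Fin K × Fin K) :
    0 ≤ rowCost M i p := by
  unfold rowCost
  split_ifs <;> positivity

theorem log_four_thirds_pos : 0 < Real.log (4 / 3) := Real.log_pos (by norm_num)

/-- The concave logarithm lies above its chord between `3/4` and `1`; this is the source of the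
constant `log (4/3)`. -/
theorem neg_mul_le_log_one_sub {u : ℝ} (h0 : 0 ≤ u) (h1 : u ≤ 1 / 4) :
    -(4 * Real.log (4 / 3) * u) ≤ Real.log (1 - u) := by
  have := strictConcaveOn_log_Ioi.concaveOn.2 (show (1 : ℝ) ∈ Set.Ioi 0 by simp)
    (show (3 / 4 : ℝ) ∈ Set.Ioi 0 by norm_num) (show 0 ≤ 1 - 4 * u by linarith)
    (show 0 ≤ 4 * u by linarith) (by ring)
  have e : Real.log (3 / 4) = -Real.log (4 / 3) := by
    rw [← Real.log_inv]; norm_num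
  simp only [smul_eq_mul, mul_one, Real.log_one, mul_zero, zero_add, e] at this
  have e2 : 1 - 4 * u + 4 * u * (3 / 4) = 1 - u := by ring
  rw [e2] at this
  linarith

/-- The divergence of a fair coin from a coin of bias `d` is `-(1/2) log (1 - 4d²)`, and `4d² ≤
1/4`. -/
theorem neg_mul_le_sum_log {d : ℝ} (hd : d ∈ Set.Icc (-(1 / 4) : ℝ) (1 / 4)) :
    -(8 * Real.log (4 / 3) * d ^ 2) ≤
      1 / 2 * Real.log ((1 / 2 + d) / (1 / 2)) + 1 / 2 * Real.log ((1 / 2 - d) / (1 / 2)) := by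
  rw [Set.mem_Icc] at hd
  have h := neg_mul_le_log_one_sub (u := 4 * d ^ 2) (by positivity) (by nlinarith)
  rw [← mul_add, ← Real.log_mul (by simp; linarith) (by simp; linarith),
    show (1 / 2 + d) / (1 / 2) * ((1 / 2 - d) / (1 / 2)) = 1 - 4 * d ^ 2 by ring]
  linarith

/-- The reverse divergence, bounded by the chi-square distance through `1 - 1/x ≤ log x`. -/
theorem neg_mul_le_sum_log_swap {d : ℝ} (hd : d ∈ Set.Icc (-(1 / 4) : ℝ) (1 / 4)) :
    -(4 * d ^ 2) ≤ (1 / 2 + d) * Real.log ((1 / 2) / (1 / 2 + d)) +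
      (1 / 2 - d) * Real.log ((1 / 2) / (1 / 2 - d)) := by
  rw [Set.mem_Icc] at hd
  have key : ∀ q : ℝ, 0 < q → q * (1 - 2 * q) ≤ q * Real.log ((1 / 2) / q) := by
    intro q hq
    have := Real.one_sub_inv_le_log_of_pos (x := (1 / 2) / q) (by positivity)
    refine mul_le_mul_of_nonneg_left (le_of_eq_of_le ?_ this) hq.le
    rw [inv_div]
    ring
  have h1 := key (1 / 2 + d) (by linarith)
  have h2 := key (1 / 2 - d) (by linarith)
  nlinarith

/-- Either the pair has the same law in `M` and in `promote M i 0`, or it is a fair duel in the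
latter, and its gap is paid for by `rowCost`. -/
theorem promote_zero_cases (hM : IsGap M) (i : Fin K) (p : Fin K × Fin K) :
    promote M i 0 p.1 p.2 = M p.1 p.2 ∨
      (promote M i 0 p.1 p.2 = 0 ∧ M p.1 p.2 ^ 2 = rowCost M i p) := by
  obtain ⟨j, k⟩ := p
  simp only [promote, rowCost]
  by_cases hj : j = i
  · subst hj
    by_cases hk : k = j
    · subst hk
      left
      simp [hM.diag]
    · rcases le_total (M j k) 0 with h | h
      · right
        simp [hk, h]
      · left
        simp [hk, h]
  · by_cases hk : k = i
    · subst hk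
      rcases le_total (M k j) 0 with h | h
      · right
        simp [hj, h, hM.2 k j]
      · left
        simp [hj, h, hM.2 k j]
    · left
      simp [hj, hk]

theorem neg_rowCost_le_sum_log (hM : IsGap M) (i : Fin K) (h : History K) (p : Fin K × Fin K) :
    -(8 * Real.log (4 / 3) * rowCost M i p) ≤ ∑ b, envKernel (promote M i 0) h p b *
      Real.log (envKernel M h p b / envKernel (promote M i 0) h p b) := by
  have hL := log_four_thirds_pos
  rcases promote_zero_cases hM i p with e | ⟨e, e2⟩
  · refine le_trans (neg_nonpos.2 (mul_nonneg (by positivity) (rowCost_nonneg _ _ _))) ?_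
    refine Finset.sum_nonneg fun b _ => ?_
    have e3 : envKernel (promote M i 0) h p b = envKernel M h p b := by
      simp only [envKernel, e]
    rw [e3, div_self (envKernel_pos hM h p b).ne', Real.log_one, mul_zero]
  · rw [← e2, Fintype.sum_bool]
    simp only [envKernel, e, cond_true, cond_false, add_zero, sub_zero]
    exact neg_mul_le_sum_log (hM.1 _ _)

theorem neg_rowCost_le_sum_log_swap (hM : IsGap M) (i : Fin K) (h : History K)
    (p : Fin K × Fin K) :
    -(4 * rowCost M i p) ≤ ∑ b, envKernel M h p b *
      Real.log (envKernel (promote M i 0) h p b / envKernel M h p b) := by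
  rcases promote_zero_cases hM i p with e | ⟨e, e2⟩
  · refine le_trans (neg_nonpos.2 (mul_nonneg (by positivity) (rowCost_nonneg _ _ _))) ?_
    refine Finset.sum_nonneg fun b _ => ?_
    have e3 : envKernel (promote M i 0) h p b = envKernel M h p b := by
      simp only [envKernel, e]
    rw [e3, div_self (envKernel_pos hM h p b).ne', Real.log_one, mul_zero]
  · rw [← e2, Fintype.sum_bool]
    simp only [envKernel, e, cond_true, cond_false, add_zero, sub_zero]
    exact neg_mul_le_sum_log_swap (hM.1 _ _)

theorem rowCost_eq_zero (M : Matrix (Fin K) (Fin K) ℝ) {i : Fin K} {p : Fin K × Fin K}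
    (hp : ¬(p.1 = i ∨ p.2 = i)) : rowCost M i p = 0 := by
  push Not at hp
  simp [rowCost, hp.1, hp.2]

theorem sum_mul_logRatio_cons {κ κ' κ₀ : OutcomeKernel K} (h1 : ∀ h p, ∑ b, κ₀ h p b = 1)
    (h : History K) (p : Fin K × Fin K) :
    ∑ b, κ₀ h p b * logRatio κ κ' ((p, b) :: h) =
      logRatio κ κ' h + ∑ b, κ₀ h p b * Real.log (κ h p b / κ' h p b) := by
  simp only [logRatio, mul_add, Finset.sum_add_distrib]
  rw [← Finset.sum_mul, h1, one_mul]

theorem promote_eq_of_ne (M : Matrix (Fin K) (Fin K) ℝ) (i : Fin K) (ε : ℝ) (j k : Fin K)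
    (hj : j ≠ i) (hk : k ≠ i) : promote M i ε j k = M j k := by
  simp [promote, hj, hk]

/-- Change of measure from the environment in which row `i` has no negative entry to an average
over environments that share it. -/
theorem average_changeOfMeasure (hδ : 0 ≤ δ) (hA : IsDeltaCorrect A δ) {i w : Fin K} (hw : w ≠ i)
    {ι : Type*} (T : Finset ι) (M : ι → Matrix (Fin K) (Fin K) ℝ)
    (M' : Matrix (Fin K) (Fin K) ℝ) (hM : ∀ t ∈ T, IsGap (M t))
    (hM' : ∀ t ∈ T, promote (M t) i 0 = M') {R : ℝ} (hR0 : 0 ≤ R)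
    (hR : ∀ j, ∑ t ∈ T, (min (M t i j) 0) ^ 2 ≤ T.card * R) (n m : ℕ) {c d : ℝ} (hcd : c ≤ d) :
    T.card * (1 + d - (d - c) * δ - 8 * Real.log (4 / 3) * R * n) ≤
      T.card * Real.exp d - (Real.exp d - Real.exp c) *
        ∑ t ∈ T, winMass A (envKernel (M t)) w m ({h | pulls i h ≤ n}.indicator 1) := by
  have hL := log_four_thirds_pos
  rcases T.eq_empty_or_nonempty with rfl | ⟨t₀, ht₀⟩
  · simp
  have hg' : IsGap M' := hM' t₀ ht₀ ▸ isGap_promote (hM t₀ ht₀) i le_rfl (by norm_num)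
  have hW' : winMass A (envKernel M') w m ({h | pulls i h ≤ n}.indicator 1) ≤ δ :=
    hM' t₀ ht₀ ▸ winMass_promote_le hδ hA (hM t₀ ht₀) hw m _
  -- The reference law `M'` is the same for all `t`, so the log-ratios can be summed over `t` inside
  -- one expectation. A round that queries column `j` then costs the sum over `t` bounded by `hR j`,
  -- whatever `j` is.
  have hcost : -((T.card * (8 * Real.log (4 / 3) * R)) * n) ≤
      leafSum A (envKernel M') m (fun h _ =>
        ∑ t ∈ T, logRatio (truncKernel (M t) M' i n) (envKernel M') h) := by
    refine neg_mul_le_leafSum (fun h p b => (envKernel_pos hg' h p b).le) (sum_envKernel M') i n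
      (by positivity) (by simp [logRatio]) (fun h p => ?_) m
    have e1 : ∑ b, envKernel M' h p b *
          ∑ t ∈ T, logRatio (truncKernel (M t) M' i n) (envKernel M') ((p, b) :: h) =
        ∑ t ∈ T, logRatio (truncKernel (M t) M' i n) (envKernel M') h +
          ∑ t ∈ T, ∑ b, envKernel M' h p b *
            Real.log (truncKernel (M t) M' i n h p b / envKernel M' h p b) := by
      simp only [Finset.mul_sum]
      rw [Finset.sum_comm, ← Finset.sum_add_distrib]
      exact Finset.sum_congr rfl fun t _ => sum_mul_logRatio_cons (sum_envKernel M') h p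
    rw [e1, sub_eq_add_neg, add_le_add_iff_left]
    by_cases hn : pulls i h < n
    · have e2 : ∀ t ∈ T, -(8 * Real.log (4 / 3) * rowCost (M t) i p) ≤
          ∑ b, envKernel M' h p b *
            Real.log (truncKernel (M t) M' i n h p b / envKernel M' h p b) := by
        intro t ht
        have := neg_rowCost_le_sum_log (hM t ht) i h p
        rw [hM' t ht] at this
        simpa only [truncKernel, hn, if_true] using this
      refine le_trans ?_ (Finset.sum_le_sum e2)
      rw [Finset.sum_neg_distrib, ← Finset.mul_sum, neg_le_neg_iff]
      by_cases hp : p.1 = i ∨ p.2 = i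
      · have e3 : ∑ t ∈ T, rowCost (M t) i p ≤ T.card * R := by
          unfold rowCost
          by_cases hp1 : p.1 = i
          · simpa only [hp1, if_true] using hR p.2
          · have hp2 : p.2 = i := hp.resolve_left hp1
            simpa only [hp1, hp2, if_true, if_false] using hR p.1
        rw [if_pos ⟨hp, hn⟩]
        calc _ ≤ 8 * Real.log (4 / 3) * (T.card * R) :=
              mul_le_mul_of_nonneg_left e3 (by positivity)
          _ = _ := by ring
      · simp [hp, rowCost_eq_zero _ hp]
    · have e2 : ∀ t b, truncKernel (M t) M' i n h p b = envKernel M' h p b := by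
        intro t b
        simp only [truncKernel, hn, if_false]
      simp only [e2, hn, and_false, if_false, neg_zero]
      refine le_of_eq (Eq.symm (Finset.sum_eq_zero fun t _ => Finset.sum_eq_zero fun b _ => ?_))
      rw [div_self (envKernel_pos hg' h p b).ne', Real.log_one, mul_zero]
  have hdp : ∀ t ∈ T, 1 + d - (d - c) * δ + leafSum A (envKernel M') m (fun h _ =>
        logRatio (truncKernel (M t) M' i n) (envKernel M') h) ≤
      Real.exp d - (Real.exp d - Real.exp c) *
        winMass A (envKernel (M t)) w m ({h | pulls i h ≤ n}.indicator 1) := by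
    intro t ht
    have := dataProcessing (A := A) (truncKernel_pos (hM t ht) hg' i n) (envKernel_pos hg')
      (sum_truncKernel _ _ _ _) (sum_envKernel _) m w {h | pulls i h ≤ n} c d
    rw [winMass_truncKernel A (fun j k hj hk => by
      rw [← hM' t ht, promote_eq_of_ne _ _ _ _ _ hj hk])] at this
    have h2 := mul_le_mul_of_nonneg_left hW' (sub_nonneg.2 hcd)
    linarith
  have hsum := Finset.sum_le_sum hdp
  rw [leafSum_sum A (envKernel M') m T fun t h _ =>
    logRatio (truncKernel (M t) M' i n) (envKernel M') h] at hcost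
  simp only [Finset.sum_add_distrib, Finset.sum_sub_distrib, Finset.sum_const, nsmul_eq_mul,
    ← Finset.mul_sum] at hsum
  linarith

/-- Change of measure towards the environment in which row `i` has no negative entry. -/
theorem changeOfMeasure_swap (hδ : 0 ≤ δ) (hA : IsDeltaCorrect A δ) (hM : IsGap M)
    {i w : Fin K} (hw : w ≠ i) {B : ℝ} (hB0 : 0 ≤ B) (hB : ∀ j, (min (M i j) 0) ^ 2 ≤ B)
    (n m : ℕ) {c d : ℝ} (hcd : d ≤ c) :
    1 + d + (c - d) * winMass A (envKernel M) w m ({h | pulls i h ≤ n}.indicator 1) -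
        4 * B * n ≤
      Real.exp d + (Real.exp c - Real.exp d) * δ := by
  set M' := promote M i 0 with hM'
  have hg' : IsGap M' := isGap_promote hM i le_rfl (by norm_num)
  have hW' : winMass A (envKernel M') w m ({h | pulls i h ≤ n}.indicator 1) ≤ δ :=
    winMass_promote_le hδ hA hM hw m _
  have hpos := truncKernel_pos hM hg' i n
  -- The expectation is now under the truncated instance itself, so each costly round is bounded by
  -- the worst squared entry `B`.
  have hcost : -((4 * B) * n) ≤ leafSum A (truncKernel M M' i n) m (fun h _ =>
      logRatio (envKernel M') (truncKernel M M' i n) h) := by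
    refine neg_mul_le_leafSum (fun h p b => (hpos h p b).le) (sum_truncKernel _ _ _ _) i n
      (by positivity) rfl (fun h p => ?_) m
    rw [sum_mul_logRatio_cons (sum_truncKernel _ _ _ _), sub_eq_add_neg, add_le_add_iff_left]
    by_cases hn : pulls i h < n
    · have := neg_rowCost_le_sum_log_swap hM i h p
      simp only [truncKernel, hn, if_true, and_true]
      refine le_trans (neg_le_neg ?_) this
      split_ifs with hp
      · refine mul_le_mul_of_nonneg_left ?_ (by norm_num)
        unfold rowCost
        split_ifs
        exacts [hB _, hB _, hB0]
      · simp [rowCost_eq_zero _ hp]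
    · have e2 : ∀ b, truncKernel M M' i n h p b = envKernel M' h p b := by
        intro b
        simp only [truncKernel, hn, if_false]
      simp only [e2, hn, and_false, if_false, neg_zero]
      refine le_of_eq (Eq.symm (Finset.sum_eq_zero fun b _ => ?_))
      rw [div_self (envKernel_pos hg' h p b).ne', Real.log_one, mul_zero]
  have := dataProcessing (A := A) (envKernel_pos hg') hpos (sum_envKernel _)
    (sum_truncKernel _ _ _ _) m w {h | pulls i h ≤ n} c d
  rw [winMass_truncKernel A (promote_eq_of_ne M i 0)] at this
  have h2 := mul_le_mul_of_nonneg_left hW' (sub_nonneg.2 (Real.exp_le_exp.2 hcd))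
  linarith

end

section

/-! ### Averages over row permutations -/

section Averages

variable {α : Type*} [Fintype α] [DecidableEq α]

/-- Right multiplication by the transposition of `x` and `y` is an involution of the stabilizer of
`a`. -/
theorem sum_perm_fixing_eq (a : α) (g : α → ℝ) {x y : α} (hx : x ≠ a) (hy : y ≠ a) :
    ∑ σ : Equiv.Perm α with σ a = a, g (σ x) = ∑ σ : Equiv.Perm α with σ a = a, g (σ y) := by
  refine Finset.sum_nbij' (fun σ => σ * Equiv.swap x y) (fun σ => σ * Equiv.swap x y) ?_ ?_ ?_ ?_ ?_
  · intro σ hσ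
    simpa [Equiv.swap_apply_of_ne_of_ne hx.symm hy.symm] using hσ
  · intro σ hσ
    simpa [Equiv.swap_apply_of_ne_of_ne hx.symm hy.symm] using hσ
  · intro σ _
    simp [mul_assoc]
  · intro σ _
    simp [mul_assoc]
  · intro σ _
    simp

/-- Over the permutations fixing `a`, the average of `g (σ x)` is the average of `g` over the
points other than `a`. -/
theorem card_sub_one_mul_sum_perm_le (a : α) {g : α → ℝ} (hg : ∀ y, 0 ≤ g y) {x : α}
    (hx : x ≠ a) :
    ((Fintype.card α : ℝ) - 1) * ∑ σ : Equiv.Perm α with σ a = a, g (σ x) ≤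
      (Finset.univ.filter fun σ : Equiv.Perm α => σ a = a).card * ∑ y, g y := by
  have e1 : ((Fintype.card α : ℝ) - 1) * ∑ σ : Equiv.Perm α with σ a = a, g (σ x) =
      ∑ y ∈ Finset.univ.erase a, ∑ σ : Equiv.Perm α with σ a = a, g (σ y) := by
    rw [Finset.sum_congr rfl fun y hy =>
      sum_perm_fixing_eq a g (Finset.ne_of_mem_erase hy) hx, Finset.sum_const,
      Finset.card_erase_of_mem (Finset.mem_univ a), nsmul_eq_mul, Finset.card_univ,
      Nat.cast_sub (Fintype.card_pos_iff.2 ⟨a⟩), Nat.cast_one]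
  rw [e1, Finset.sum_comm, ← nsmul_eq_mul]
  refine Finset.sum_le_card_nsmul _ _ _ fun σ _ => ?_
  rw [← Equiv.sum_comp σ g]
  exact Finset.sum_le_sum_of_subset_of_nonneg (Finset.subset_univ _) fun _ _ _ => hg _

/-- A bound on all averages over one coordinate is a bound on the full average. -/
theorem sum_piFinset_le_of_sum_update_le {β : α → Type*} [∀ a, DecidableEq (β a)]
    (T : (a : α) → Finset (β a)) (a : α) (hT : (T a).Nonempty) (f : (∀ a, β a) → ℝ) (C : ℝ)
    (hf : ∀ π ∈ Fintype.piFinset T,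
      ∑ σ ∈ T a, f (Function.update π a σ) ≤ (T a).card * C) :
    ∑ π ∈ Fintype.piFinset T, f π ≤ (Fintype.piFinset T).card * C := by
  have hmem : ∀ π ∈ Fintype.piFinset T, ∀ σ ∈ T a, Function.update π a σ ∈ Fintype.piFinset T := by
    intro π hπ σ hσ
    rw [Fintype.mem_piFinset] at hπ ⊢
    intro b
    by_cases hb : b = a
    · subst hb
      simpa using hσ
    · simpa [hb] using hπ b
  have e1 : ∑ π ∈ Fintype.piFinset T, ∑ σ ∈ T a, f (Function.update π a σ) =
      ∑ π ∈ Fintype.piFinset T, ∑ σ ∈ T a, f π := by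
    rw [← Finset.sum_product', ← Finset.sum_product']
    -- Exchanging the coordinate `π a` with `σ` is an involution of the pairs `(π, σ)`.
    refine Finset.sum_nbij' (fun x => (Function.update x.1 a x.2, x.1 a))
      (fun x => (Function.update x.1 a x.2, x.1 a)) ?_ ?_ ?_ ?_ ?_
    · intro x hx
      rw [Finset.mem_product] at hx ⊢
      exact ⟨hmem _ hx.1 _ hx.2, Fintype.mem_piFinset.1 hx.1 a⟩
    · intro x hx
      rw [Finset.mem_product] at hx ⊢
      exact ⟨hmem _ hx.1 _ hx.2, Fintype.mem_piFinset.1 hx.1 a⟩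
    · intro x _
      simp
    · intro x _
      simp
    · intro x _
      simp
  have h2 := Finset.sum_le_sum hf
  rw [e1] at h2
  simp only [Finset.sum_const, nsmul_eq_mul, ← Finset.mul_sum] at h2
  have hpos : (0 : ℝ) < (T a).card := by exact_mod_cast hT.card_pos
  refine le_of_mul_le_mul_left ?_ hpos
  linarith

end Averages

/-! ### Permuted instances -/

variable {K : ℕ} {Δ : Matrix (Fin K) (Fin K) ℝ} {w : Fin K}

open scoped Classical in
/-- The permutations of the negative positions of row `i` that fix the position `w`. -/
noncomputable def rowPermsFixing (Δ : Matrix (Fin K) (Fin K) ℝ) (w i : Fin K) :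
    Finset (Equiv.Perm {j : Fin K // Δ i j < 0}) :=
  Finset.univ.filter fun σ => ∀ h : Δ i w < 0, σ ⟨w, h⟩ = ⟨w, h⟩

theorem rowPermsFixing_nonempty (Δ : Matrix (Fin K) (Fin K) ℝ) (w i : Fin K) :
    (rowPermsFixing Δ w i).Nonempty :=
  ⟨1, by simp [rowPermsFixing]⟩

open scoped Classical in
theorem mem_piFinset_rowPermsFixing {π : RowPerms Δ} :
    π ∈ Fintype.piFinset (rowPermsFixing Δ w) ↔ FixesWinner w π := by
  simp [rowPermsFixing, FixesWinner]

theorem permuted_of_neg (π : RowPerms Δ) {i j : Fin K} (h : Δ i j < 0) :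
    permuted Δ π i j = Δ i (π i ⟨j, h⟩) := by
  simp [permuted, h]

theorem permuted_of_neg_swap (hΔ : IsGap Δ) (π : RowPerms Δ) {i j : Fin K} (h : Δ j i < 0) :
    permuted Δ π i j = -Δ j (π j ⟨i, h⟩) := by
  have h2 : ¬Δ i j < 0 := by rw [hΔ.2 j i]; linarith
  simp [permuted, h, h2]

theorem permuted_of_zero (hΔ : IsGap Δ) (π : RowPerms Δ) {i j : Fin K} (h : Δ i j = 0) :
    permuted Δ π i j = 0 := by
  have h2 : Δ j i = 0 := by rw [hΔ.2 i j, h, neg_zero]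
  simp [permuted, h, h2]

theorem permuted_neg_iff (hΔ : IsGap Δ) (π : RowPerms Δ) (i j : Fin K) :
    permuted Δ π i j < 0 ↔ Δ i j < 0 := by
  rcases lt_trichotomy (Δ i j) 0 with h | h | h
  · rw [permuted_of_neg π h]
    simp [h, (π i ⟨j, h⟩).2]
  · simp [permuted_of_zero hΔ π h, h]
  · have h2 : Δ j i < 0 := by rw [hΔ.2 i j]; linarith
    rw [permuted_of_neg_swap hΔ π h2]
    have := (π j ⟨i, h2⟩).2
    constructor <;> intro <;> linarith

theorem isGap_permuted (hΔ : IsGap Δ) (π : RowPerms Δ) : IsGap (permuted Δ π) := by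
  constructor
  · intro i j
    rcases lt_trichotomy (Δ i j) 0 with h | h | h
    · rw [permuted_of_neg π h]
      exact hΔ.1 _ _
    · rw [permuted_of_zero hΔ π h]
      norm_num
    · have h2 : Δ j i < 0 := by rw [hΔ.2 i j]; linarith
      rw [permuted_of_neg_swap hΔ π h2]
      have := hΔ.1 j (π j ⟨i, h2⟩)
      rw [Set.mem_Icc] at this ⊢
      constructor <;> linarith
  · intro i j
    rcases lt_trichotomy (Δ i j) 0 with h | h | h
    · rw [permuted_of_neg π h, permuted_of_neg_swap hΔ π h]
    · rw [permuted_of_zero hΔ π h, permuted_of_zero hΔ π (by rw [hΔ.2 i j, h, neg_zero]), neg_zero]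
    · have h2 : Δ j i < 0 := by rw [hΔ.2 i j]; linarith
      rw [permuted_of_neg_swap hΔ π h2, permuted_of_neg π h2, neg_neg]

theorem permuted_winner (hΔ : IsGap Δ) (hw : IsCW Δ w) {π : RowPerms Δ} (hπ : FixesWinner w π)
    {i : Fin K} (hi : i ≠ w) : permuted Δ π w i = Δ w i := by
  have h : Δ i w < 0 := by rw [hΔ.2 w i]; linarith [hw i hi]
  rw [permuted_of_neg_swap hΔ π h, hπ i h, hΔ.2 w i, neg_neg]

theorem isCW_permuted (hΔ : IsGap Δ) (hw : IsCW Δ w) {π : RowPerms Δ} (hπ : FixesWinner w π) :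
    IsCW (permuted Δ π) w := fun j hj => by
  rw [permuted_winner hΔ hw hπ hj]
  exact hw j hj

theorem negCount_permuted (hΔ : IsGap Δ) (π : RowPerms Δ) (i : Fin K) :
    negCount (permuted Δ π) i = negCount Δ i := by
  unfold negCount
  congr 1
  exact Finset.filter_congr fun j _ => permuted_neg_iff hΔ π i j

theorem map_filter_neg_val (Δ : Matrix (Fin K) (Fin K) ℝ) (i : Fin K) (f : Fin K → ℝ) :
    (Finset.univ.filter fun j => Δ i j < 0).val.map f =
      (Finset.univ : Finset {j : Fin K // Δ i j < 0}).val.map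
        fun j : {j : Fin K // Δ i j < 0} => f j.1 := by
  rw [← Finset.univ_val_map_subtype_val, Multiset.map_map]
  rfl

theorem ordGap_permuted (hΔ : IsGap Δ) (π : RowPerms Δ) (i : Fin K) (r : ℕ) :
    ordGap (permuted Δ π) i r = ordGap Δ i r := by
  have e : (Finset.univ.filter fun j => permuted Δ π i j < 0) =
      Finset.univ.filter fun j => Δ i j < 0 :=
    Finset.filter_congr fun j _ => permuted_neg_iff hΔ π i j
  have e2 : (Finset.univ.filter fun j => permuted Δ π i j < 0).val.map (permuted Δ π i) =
      (Finset.univ.filter fun j => Δ i j < 0).val.map (Δ i) := by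
    rw [e, map_filter_neg_val, map_filter_neg_val]
    conv_rhs => rw [← Multiset.map_univ_val_equiv (π i), Multiset.map_map]
    exact Multiset.map_congr rfl fun j _ => permuted_of_neg π j.2
  simp only [ordGap, e2]

theorem min_permuted_of_nonneg (hΔ : IsGap Δ) (π : RowPerms Δ) {i j : Fin K} (h : ¬Δ i j < 0) :
    min (permuted Δ π i j) 0 = 0 :=
  min_eq_right (not_lt.1 fun h2 => h ((permuted_neg_iff hΔ π i j).1 h2))

/-- The permutation of row `i` moves only its negative entries, which `promote` erases; the positive
entries of row `i` are governed by the permutations of the other rows. -/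
theorem promote_permuted_update (hΔ : IsGap Δ) (π : RowPerms Δ) (i : Fin K)
    (σ : Equiv.Perm {j : Fin K // Δ i j < 0}) :
    promote (permuted Δ (Function.update π i σ)) i 0 = promote (permuted Δ π) i 0 := by
  have hmax : ∀ j, j ≠ i → max (permuted Δ (Function.update π i σ) i j) 0 =
      max (permuted Δ π i j) 0 := by
    intro j hj
    rcases lt_trichotomy (Δ i j) 0 with h | h | h
    · rw [max_eq_right ((permuted_neg_iff hΔ _ i j).2 h).le,
        max_eq_right ((permuted_neg_iff hΔ _ i j).2 h).le]
    · rw [permuted_of_zero hΔ _ h, permuted_of_zero hΔ _ h]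
    · have h2 : Δ j i < 0 := by rw [hΔ.2 i j]; linarith
      rw [permuted_of_neg_swap hΔ _ h2, permuted_of_neg_swap hΔ _ h2,
        Function.update_of_ne hj]
  ext j k
  unfold promote
  split_ifs with hj hk hk
  · rfl
  · exact hmax k hk
  · rw [hmax j hj]
  · unfold permuted
    rw [Function.update_of_ne hj, Function.update_of_ne hk]

theorem negCount_pos (hΔ : IsGap Δ) (hw : IsCW Δ w) {i : Fin K} (hi : i ≠ w) :
    0 < negCount Δ i :=
  Finset.card_pos.2 ⟨w, by
    simp only [Finset.mem_filter, Finset.mem_univ, true_and]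
    rw [hΔ.2 w i]
    linarith [hw i hi]⟩

theorem sq_winner_le_negNormSq (hΔ : IsGap Δ) (hw : IsCW Δ w) {i : Fin K} (hi : i ≠ w) :
    (Δ w i) ^ 2 ≤ negNormSq Δ i := by
  refine le_trans (le_of_eq ?_) (Finset.single_le_sum (f := fun j => (min (Δ i j) 0) ^ 2)
    (fun j _ => sq_nonneg _) (Finset.mem_univ w))
  have : Δ i w < 0 := by rw [hΔ.2 w i]; linarith [hw i hi]
  rw [min_eq_left this.le, hΔ.2 w i]
  ring

theorem sum_subtype_neg (Δ : Matrix (Fin K) (Fin K) ℝ) (i : Fin K) :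
    ∑ j : {j : Fin K // Δ i j < 0}, (Δ i j) ^ 2 = negNormSq Δ i := by
  have e : ∑ j : {j : Fin K // Δ i j < 0}, (Δ i j) ^ 2 =
      ∑ j with Δ i j < 0, (Δ i j) ^ 2 :=
    (Finset.sum_subtype _ (fun j => by simp) fun j => (Δ i j) ^ 2).symm
  rw [e, Finset.sum_filter]
  refine Finset.sum_congr rfl fun j _ => ?_
  split_ifs with h
  · rw [min_eq_left h.le]
  · rw [min_eq_right (not_lt.1 h)]
    norm_num

/-- The inverse of the sample complexity attached to row `i`. -/
noncomputable def rowRate (Δ : Matrix (Fin K) (Fin K) ℝ) (w i : Fin K) : ℝ :=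
  max ((Δ w i) ^ 2) (negNormSq Δ i / negCount Δ i)

theorem rowRate_pos (hw : IsCW Δ w) {i : Fin K} (hi : i ≠ w) : 0 < rowRate Δ w i :=
  lt_max_of_lt_left (pow_pos (hw i hi) 2)

/-- Column `w` always shows `Δ_{i,w}`. Any other negative column shows a uniform choice among the
`K_{i;<0} - 1` remaining entries; the factor `2` pays for `K_{i;<0} ≤ 2 (K_{i;<0} - 1)`. -/
theorem sum_sq_permuted_update_le (hΔ : IsGap Δ) (hw : IsCW Δ w) {i : Fin K} (hi : i ≠ w)
    (π : RowPerms Δ) (j : Fin K) :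
    ∑ σ ∈ rowPermsFixing Δ w i,
        (min (permuted Δ (Function.update π i σ) i j) 0) ^ 2 ≤
      (rowPermsFixing Δ w i).card * (2 * rowRate Δ w i) := by
  classical
  have hr := rowRate_pos hw hi
  by_cases hj : Δ i j < 0
  swap
  · rw [Finset.sum_eq_zero fun σ _ => by rw [min_permuted_of_nonneg hΔ _ hj]; norm_num]
    positivity
  have hwi : Δ i w < 0 := by rw [hΔ.2 w i]; linarith [hw i hi]
  have e1 : ∀ σ : Equiv.Perm {j : Fin K // Δ i j < 0},
      (min (permuted Δ (Function.update π i σ) i j) 0) ^ 2 = (Δ i (σ ⟨j, hj⟩)) ^ 2 := by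
    intro σ
    rw [min_eq_left ((permuted_neg_iff hΔ _ i j).2 hj).le, permuted_of_neg _ hj,
      Function.update_self]
  simp only [e1]
  by_cases hjw : j = w
  · subst hjw
    rw [← nsmul_eq_mul]
    refine Finset.sum_le_card_nsmul _ _ _ fun σ hσ => ?_
    have hσ' : σ ⟨j, hj⟩ = ⟨j, hj⟩ := by
      simp only [rowPermsFixing, Finset.mem_filter] at hσ
      exact hσ.2 hj
    rw [hσ', hΔ.2 j i, neg_sq]
    have : (Δ j i) ^ 2 ≤ rowRate Δ j i := le_max_left _ _
    linarith
  · have hT : rowPermsFixing Δ w i =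
        Finset.univ.filter fun σ : Equiv.Perm {j : Fin K // Δ i j < 0} =>
          σ ⟨w, hwi⟩ = ⟨w, hwi⟩ := by
      ext σ
      simp [rowPermsFixing, hwi]
    have key := card_sub_one_mul_sum_perm_le (⟨w, hwi⟩ : {j : Fin K // Δ i j < 0})
      (g := fun y => (Δ i y) ^ 2) (fun _ => sq_nonneg _) (x := ⟨j, hj⟩)
      (fun h => hjw (congrArg Subtype.val h))
    have hcard : Fintype.card {j : Fin K // Δ i j < 0} = negCount Δ i := by
      rw [Fintype.card_subtype]; rfl
    have hc2 : 2 ≤ negCount Δ i := by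
      refine Finset.one_lt_card.2 ⟨j, by simpa using hj, w, by simpa using hwi, hjw⟩
    rw [hcard, sum_subtype_neg] at key
    rw [hT]
    have hc2' : (2 : ℝ) ≤ negCount Δ i := by exact_mod_cast hc2
    have hrate : negNormSq Δ i ≤ negCount Δ i * rowRate Δ w i := by
      have : negNormSq Δ i / negCount Δ i ≤ rowRate Δ w i := le_max_right _ _
      rw [div_le_iff₀ (by linarith)] at this
      linarith
    refine le_of_mul_le_mul_left (key.trans ?_) (show (0 : ℝ) < negCount Δ i - 1 by linarith)
    have h3 : negNormSq Δ i ≤ (negCount Δ i - 1) * (2 * rowRate Δ w i) := by nlinarith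
    calc _ ≤ _ := mul_le_mul_of_nonneg_left h3 (Nat.cast_nonneg _)
      _ = _ := by ring

theorem min_inv_eq_inv_rowRate (hΔ : IsGap Δ) (hw : IsCW Δ w) {i : Fin K} (hi : i ≠ w) :
    min (1 / (Δ w i) ^ 2) ((negCount Δ i : ℝ) / negNormSq Δ i) = 1 / rowRate Δ w i := by
  have h1 : 0 < (Δ w i) ^ 2 := pow_pos (hw i hi) 2
  have h2 : 0 < negNormSq Δ i := h1.trans_le (sq_winner_le_negNormSq hΔ hw hi)
  have h3 : (0 : ℝ) < negCount Δ i := by exact_mod_cast negCount_pos hΔ hw hi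
  have h4 : 0 < negNormSq Δ i / negCount Δ i := by positivity
  rw [rowRate, ← one_div_div (negNormSq Δ i)]
  rcases le_total ((Δ w i) ^ 2) (negNormSq Δ i / negCount Δ i) with h | h
  · rw [max_eq_right h, min_eq_right (one_div_le_one_div_of_le h1 h)]
  · rw [max_eq_left h, min_eq_left (one_div_le_one_div_of_le h4 h)]

end

section

/-! ### Lower bounds on the quantile of the budget -/

variable {K : ℕ} {A : Algorithm K} {Δ M : Matrix (Fin K) (Fin K) ℝ} {w : Fin K} {δ x : ℝ}

theorem pulls_le_length (i : Fin K) (h : History K) : pulls i h ≤ h.length := by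
  induction h with
  | nil => simp [pulls]
  | cons r h ih =>
    obtain ⟨p, b⟩ := r
    simp only [pulls, List.length_cons]
    split_ifs <;> omega

theorem sum_pulls_le (h : History K) : ∑ i, pulls i h ≤ 2 * h.length := by
  induction h with
  | nil => simp [pulls]
  | cons r h ih =>
    obtain ⟨p, b⟩ := r
    simp only [pulls, List.length_cons, Finset.sum_add_distrib]
    have : ∑ i, (if p.1 = i ∨ p.2 = i then 1 else 0) ≤
        ∑ i, ((if p.1 = i then 1 else 0) + if p.2 = i then 1 else 0) := by
      refine Finset.sum_le_sum fun i _ => ?_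
      by_cases h1 : p.1 = i <;> by_cases h2 : p.2 = i <;> simp [h1, h2]
    simp only [Finset.sum_add_distrib, Finset.sum_ite_eq, Finset.mem_univ, if_true] at this
    omega

theorem winMass_sub (A : Algorithm K) (κ : OutcomeKernel K) (w : Fin K) (m : ℕ)
    (φ ψ : History K → ℝ) :
    winMass A κ w m (fun h => φ h - ψ h) = winMass A κ w m φ - winMass A κ w m ψ := by
  simp only [winMass, mul_sub, Finset.sum_sub_distrib]

theorem winMass_sum (A : Algorithm K) (κ : OutcomeKernel K) (w : Fin K) (m : ℕ) {ι : Type*}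
    (N : Finset ι) (φ : ι → History K → ℝ) :
    winMass A κ w m (fun h => ∑ i ∈ N, φ i h) = ∑ i ∈ N, winMass A κ w m (φ i) := by
  classical
  induction N using Finset.induction_on with
  | empty => simp [winMass]
  | insert a N ha ih =>
    rw [Finset.sum_insert ha, ← ih]
    simp only [Finset.sum_insert ha, winMass, mul_add, Finset.sum_add_distrib]

/-- With the cut at `n + 1`, every history counted has length at most `n`, so the restriction on
pulls is void. -/
theorem winMass_indicator_pulls (A : Algorithm K) (κ : OutcomeKernel K) (w i : Fin K) (n : ℕ) :
    winMass A κ w (n + 1) ({h | pulls i h ≤ n}.indicator 1) = winMass A κ w (n + 1) 1 := by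
  unfold winMass
  refine Finset.sum_congr rfl fun l hl => Finset.sum_congr rfl fun h hh => ?_
  have h1 := Finset.mem_range.1 hl
  have h2 := length_of_mem_histories l h hh
  have h3 := pulls_le_length i h
  have h4 : h ∈ {h : History K | pulls i h ≤ n} := by
    change pulls i h ≤ n
    omega
  rw [Set.indicator_of_mem h4]

/-- Every arm `i` that is pulled more than `t i` times contributes `t i` to twice the budget. -/
theorem sum_mul_winMass_sub_le {κ : OutcomeKernel K} (h0 : ∀ h p b, 0 ≤ κ h p b)
    (h1 : ∀ h p, ∑ b, κ h p b = 1) (w : Fin K) (N : Finset (Fin K)) {t : Fin K → ℝ}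
    (ht : ∀ i ∈ N, 0 ≤ t i) (n : ℕ) :
    ∑ i ∈ N, t i * (winMass A κ w (n + 1) 1 -
        winMass A κ w (n + 1) ({h | pulls i h ≤ ⌊t i⌋₊}.indicator 1)) ≤ 2 * n := by
  classical
  have e : ∑ i ∈ N, t i * (winMass A κ w (n + 1) 1 -
        winMass A κ w (n + 1) ({h | pulls i h ≤ ⌊t i⌋₊}.indicator 1)) =
      winMass A κ w (n + 1) (fun h => ∑ i ∈ N, t i *
        ((1 : History K → ℝ) h - {h | pulls i h ≤ ⌊t i⌋₊}.indicator 1 h)) := by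
    rw [winMass_sum]
    refine Finset.sum_congr rfl fun i _ => ?_
    rw [winMass_const_mul, winMass_sub]
  rw [e]
  have key : winMass A κ w (n + 1) (fun h => ∑ i ∈ N, t i *
        ((1 : History K → ℝ) h - {h | pulls i h ≤ ⌊t i⌋₊}.indicator 1 h)) ≤
      winMass A κ w (n + 1) (fun h => 2 * n * (1 : History K → ℝ) h) := by
    refine winMass_mono h0 w _ fun l hl h hh => ?_
    have hlen : h.length ≤ n := by rw [length_of_mem_histories l h hh]; omega
    have h3 : ∑ i ∈ N, t i *
        ((1 : History K → ℝ) h - {h | pulls i h ≤ ⌊t i⌋₊}.indicator 1 h) ≤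
        ∑ i ∈ N, (pulls i h : ℝ) := by
      refine Finset.sum_le_sum fun i hi => ?_
      by_cases hp : pulls i h ≤ ⌊t i⌋₊
      · rw [Set.indicator_of_mem (show h ∈ {h | pulls i h ≤ ⌊t i⌋₊} from hp)]
        simp
      · rw [Set.indicator_of_notMem (show h ∉ {h | pulls i h ≤ ⌊t i⌋₊} from hp)]
        simp only [Pi.one_apply, sub_zero, mul_one]
        exact ((Nat.floor_lt (ht i hi)).1 (not_le.1 hp)).le
    have h4 : ∑ i ∈ N, (pulls i h : ℝ) ≤ ∑ i, (pulls i h : ℝ) :=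
      Finset.sum_le_sum_of_subset_of_nonneg (Finset.subset_univ _) fun _ _ _ => Nat.cast_nonneg _
    have h5 : ∑ i, (pulls i h : ℝ) ≤ 2 * n := by
      have := sum_pulls_le h
      exact_mod_cast this.trans (by omega)
    simpa using h3.trans (h4.trans h5)
  refine key.trans ?_
  rw [winMass_const_mul]
  have := winMass_one_le (A := A) h0 h1 w (n + 1)
  calc (2 * n : ℝ) * winMass A κ w (n + 1) 1 ≤ 2 * n * 1 := by gcongr
    _ = 2 * n := mul_one _

/-- The budget exceeds `x` with probability at most `δ` on all the instances that are obtained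
from `Δ` by permutations of the negative entries that fix the position `w`. -/
def UniformQuantileLE {K : ℕ} (A : Algorithm K) (Δ : Matrix (Fin K) (Fin K) ℝ) (w : Fin K)
    (δ x : ℝ) : Prop :=
  ∀ π : RowPerms Δ, FixesWinner w π →
    runLaw A (permuted Δ π) {o | (x : EReal) < budget o} ≤ ENNReal.ofReal δ

theorem fixesWinner_update {π : RowPerms Δ} (hπ : FixesWinner w π) (i : Fin K)
    {σ : Equiv.Perm {j : Fin K // Δ i j < 0}} (hσ : σ ∈ rowPermsFixing Δ w i) :
    FixesWinner w (Function.update π i σ) := by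
  intro j hj
  by_cases h : j = i
  · subst h
    rw [Function.update_self]
    simp only [rowPermsFixing, Finset.mem_filter] at hσ
    exact hσ.2 hj
  · rw [Function.update_of_ne h]
    exact hπ j hj

theorem row_changeOfMeasure (hδ : 0 ≤ δ) (hA : IsDeltaCorrect A δ) (hΔ : IsGap Δ)
    (hw : IsCW Δ w) {i : Fin K} (hi : i ≠ w) (π : RowPerms Δ) (n m : ℕ) {c d : ℝ} (hcd : c ≤ d) :
    (rowPermsFixing Δ w i).card *
        (1 + d - (d - c) * δ - 16 * Real.log (4 / 3) * rowRate Δ w i * n) ≤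
      (rowPermsFixing Δ w i).card * Real.exp d - (Real.exp d - Real.exp c) *
        ∑ σ ∈ rowPermsFixing Δ w i,
          winMass A (envKernel (permuted Δ (Function.update π i σ))) w m
            ({h | pulls i h ≤ n}.indicator 1) := by
  have := average_changeOfMeasure hδ hA hi.symm (rowPermsFixing Δ w i)
    (fun σ => permuted Δ (Function.update π i σ)) (promote (permuted Δ π) i 0)
    (fun σ _ => isGap_permuted hΔ _) (fun σ _ => promote_permuted_update hΔ π i σ)
    (by have := rowRate_pos hw hi; positivity)
    (sum_sq_permuted_update_le hΔ hw hi π) n m hcd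
  linarith

/-- The gap between the two logarithms is `log 3 ≥ 1`, and the two subtracted terms together are at
most `1/2 + 1/2`. -/
theorem one_div_six_mul_le (hδ : 0 < δ) (hδ' : δ ≤ 1 / 12) :
    Real.log (1 / (6 * δ)) ≤
      Real.log (1 / (2 * δ)) - (Real.log (1 / (2 * δ)) + 1) * δ - Real.exp (-1) := by
  have e1 : Real.log (1 / (2 * δ)) = Real.log (1 / (6 * δ)) + Real.log 3 := by
    rw [← Real.log_mul (by positivity) (by norm_num)]
    congr 1
    field_simp
    norm_num
  have h3 : 1 ≤ Real.log 3 := by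
    rw [Real.le_log_iff_exp_le (by norm_num)]
    linarith [Real.exp_one_lt_d9]
  have he : Real.exp (-1) ≤ 1 / 2 := by
    rw [Real.exp_neg, ← one_div]
    refine one_div_le_one_div_of_le (by norm_num) ?_
    linarith [Real.add_one_le_exp (1 : ℝ)]
  have h4 : Real.log (1 / (2 * δ)) * δ ≤ 1 / 2 - δ := by
    have := Real.log_le_sub_one_of_pos (x := 1 / (2 * δ)) (by positivity)
    calc _ ≤ (1 / (2 * δ) - 1) * δ := by gcongr
      _ = _ := by field_simp
  linarith

theorem row_lower_bound (hδ : 0 < δ) (hδ' : δ ≤ 1 / 12) (hA : IsDeltaCorrect A δ)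
    (hΔ : IsGap Δ) (hw : IsCW Δ w) (hx : 0 ≤ x) (hN : UniformQuantileLE A Δ w δ x)
    {i : Fin K} (hi : i ≠ w) :
    Real.log (1 / (6 * δ)) ≤ 16 * Real.log (4 / 3) * rowRate Δ w i * x := by
  have hL := log_four_thirds_pos
  have hr := rowRate_pos hw hi
  have hcard : (0 : ℝ) < (rowPermsFixing Δ w i).card := by
    exact_mod_cast (rowPermsFixing_nonempty Δ w i).card_pos
  have hd : 0 ≤ Real.log (1 / (2 * δ)) := by
    refine Real.log_nonneg ?_
    rw [le_div_iff₀ (by positivity)]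
    linarith
  have hone : FixesWinner w (1 : RowPerms Δ) := fun _ _ => rfl
  -- With `exp d = 1/(2δ)`, the mass `2δ` possibly missing from the event contributes at most `1` to
  -- the exponential moment; `c = -1` leaves at most `exp (-1)` from the event itself.
  have key := row_changeOfMeasure hδ.le hA hΔ hw hi 1 ⌊x⌋₊ (⌊x⌋₊ + 1)
    (c := -1) (d := Real.log (1 / (2 * δ))) (by linarith)
  have hW : (rowPermsFixing Δ w i).card * (1 - 2 * δ) ≤ ∑ σ ∈ rowPermsFixing Δ w i,
      winMass A (envKernel (permuted Δ (Function.update (1 : RowPerms Δ) i σ))) w (⌊x⌋₊ + 1)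
        ({h | pulls i h ≤ ⌊x⌋₊}.indicator 1) := by
    rw [← nsmul_eq_mul]
    refine Finset.card_nsmul_le_sum _ _ _ fun σ hσ => ?_
    rw [winMass_indicator_pulls]
    have hf := fixesWinner_update hone i hσ
    exact le_winMass_of_isDeltaCorrect hδ.le hA (isGap_permuted hΔ _) (isCW_permuted hΔ hw hf) hx
      (hN _ hf)
  have he1 : Real.exp (-1) < 1 := by
    rw [Real.exp_lt_one_iff]; norm_num
  have he0 := Real.exp_pos (-1)
  rw [Real.exp_log (by positivity)] at key
  have hinv : 1 ≤ 1 / (2 * δ) := by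
    rw [le_div_iff₀ (by positivity)]
    linarith
  have h2 := mul_le_mul_of_nonneg_left hW (show 0 ≤ 1 / (2 * δ) - Real.exp (-1) by linarith)
  have h3 : (rowPermsFixing Δ w i).card * (1 + Real.log (1 / (2 * δ)) -
        (Real.log (1 / (2 * δ)) - -1) * δ - 16 * Real.log (4 / 3) * rowRate Δ w i * ⌊x⌋₊) ≤
      (rowPermsFixing Δ w i).card * (1 / (2 * δ) - (1 / (2 * δ) - Real.exp (-1)) *
        (1 - 2 * δ)) := by linarith
  have h4 := le_of_mul_le_mul_left h3 hcard
  have h5 : 1 / (2 * δ) - (1 / (2 * δ) - Real.exp (-1)) * (1 - 2 * δ) ≤ 1 + Real.exp (-1) := by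
    have e : 1 / (2 * δ) - (1 / (2 * δ) - Real.exp (-1)) * (1 - 2 * δ) =
        1 + Real.exp (-1) - 2 * δ * Real.exp (-1) := by
      field_simp
      ring
    have : 0 ≤ 2 * δ * Real.exp (-1) := by positivity
    linarith
  have h6 := one_div_six_mul_le hδ hδ'
  have h7 : 16 * Real.log (4 / 3) * rowRate Δ w i * ⌊x⌋₊ ≤
      16 * Real.log (4 / 3) * rowRate Δ w i * x :=
    mul_le_mul_of_nonneg_left (Nat.floor_le hx) (by positivity)
  linarith

/-- Averaged over all `π`, the winner is recommended with at most `t i` pulls of `i` with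
probability at most `7/15`. Since it is recommended in time with probability at least `5/6`, arm `i`
has more than `t i` pulls with average probability at least `11/30`. -/
theorem sum_lower_bound (hδ : 0 < δ) (hδ' : δ ≤ 1 / 12) (hA : IsDeltaCorrect A δ)
    (hΔ : IsGap Δ) (hw : IsCW Δ w) (hx : 0 ≤ x) (hN : UniformQuantileLE A Δ w δ x) :
    11 * ∑ i with i ≠ w, 1 / rowRate Δ w i ≤ 2880 * Real.log (4 / 3) * x := by
  classical
  have hL := log_four_thirds_pos
  have hL2 : (0.6931 : ℝ) < Real.log 2 := lt_trans (by norm_num) Real.log_two_gt_d9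
  set t : Fin K → ℝ := fun i => 1 / (48 * Real.log (4 / 3) * rowRate Δ w i) with ht
  have ht0 : ∀ i ∈ Finset.univ.filter (· ≠ w), 0 ≤ t i := fun i hi => by
    have := rowRate_pos hw (Finset.mem_filter.1 hi).2
    positivity
  set W : RowPerms Δ → Fin K → ℝ := fun π i => winMass A (envKernel (permuted Δ π)) w (⌊x⌋₊ + 1)
    ({h | pulls i h ≤ ⌊t i⌋₊}.indicator 1) with hW
  set T := Fintype.piFinset (rowPermsFixing Δ w) with hT
  have hcard : (0 : ℝ) < T.card := by
    exact_mod_cast (Fintype.piFinset_nonempty.2 (rowPermsFixing_nonempty Δ w)).card_pos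
  have h1 : ∀ i, i ≠ w → ∑ π ∈ T, W π i ≤ T.card * (7 / 15) := by
    intro i hi
    have hr := rowRate_pos hw hi
    refine sum_piFinset_le_of_sum_update_le (rowPermsFixing Δ w) i
      (rowPermsFixing_nonempty Δ w i) (fun π => W π i) _ fun π _ => ?_
    have hc : (0 : ℝ) ≤ (rowPermsFixing Δ w i).card := Nat.cast_nonneg _
    -- Here `exp d - exp c = 2 - 1/4 = 7/4`, and the choice of `t` makes the information cost at
    -- most `1/3`. The left side is then at least `2 - 49/60`, whence `7/15 = (49/60) / (7/4)`.
    have key := row_changeOfMeasure hδ.le hA hΔ hw hi π ⌊t i⌋₊ (⌊x⌋₊ + 1)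
      (c := -(2 * Real.log 2)) (d := Real.log 2) (by linarith)
    have e1 : Real.exp (-(2 * Real.log 2)) = 1 / 4 := by
      rw [Real.exp_neg, mul_comm, Real.exp_mul, Real.exp_log (by norm_num)]
      norm_num
    rw [e1, Real.exp_log (by norm_num)] at key
    have h2 : 16 * Real.log (4 / 3) * rowRate Δ w i * ⌊t i⌋₊ ≤ 1 / 3 := by
      calc _ ≤ 16 * Real.log (4 / 3) * rowRate Δ w i * t i :=
            mul_le_mul_of_nonneg_left (Nat.floor_le (by positivity)) (by positivity)
        _ = 1 / 3 := by
          simp only [ht]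
          field_simp
          norm_num
    have h3 : 2 - 49 / 60 ≤ 1 + Real.log 2 - (Real.log 2 - -(2 * Real.log 2)) * δ -
        16 * Real.log (4 / 3) * rowRate Δ w i * ⌊t i⌋₊ := by nlinarith
    have h4 := mul_le_mul_of_nonneg_left h3 hc
    linarith
  have h2 : ∀ π ∈ T, ∑ i with i ≠ w, t i * (1 - 2 * δ - W π i) ≤ 2 * x := by
    intro π hπ
    have hf := mem_piFinset_rowPermsFixing.1 hπ
    have hg := isGap_permuted hΔ π
    have hwin := le_winMass_of_isDeltaCorrect hδ.le hA hg (isCW_permuted hΔ hw hf) hx (hN _ hf)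
    have := sum_mul_winMass_sub_le (A := A) (fun h p b => (envKernel_pos hg h p b).le)
      (sum_envKernel _) w (Finset.univ.filter (· ≠ w)) ht0 ⌊x⌋₊
    refine le_trans (Finset.sum_le_sum fun i hi => ?_) (this.trans ?_)
    · exact mul_le_mul_of_nonneg_left (sub_le_sub_right hwin _) (ht0 i hi)
    · linarith [Nat.floor_le hx]
  have h3 := Finset.sum_le_sum h2
  rw [Finset.sum_comm] at h3
  have h4 : ∑ i with i ≠ w, T.card * (t i * (11 / 30)) ≤
      ∑ i with i ≠ w, ∑ π ∈ T, t i * (1 - 2 * δ - W π i) := by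
    refine Finset.sum_le_sum fun i hi => ?_
    rw [← Finset.mul_sum, Finset.sum_sub_distrib, Finset.sum_const, nsmul_eq_mul]
    have := h1 i (Finset.mem_filter.1 hi).2
    have h6 : T.card * (11 / 30 : ℝ) ≤ T.card * (1 - 2 * δ) - ∑ π ∈ T, W π i := by
      nlinarith
    have := mul_le_mul_of_nonneg_left h6 (ht0 i hi)
    linarith
  rw [Finset.sum_const, nsmul_eq_mul] at h3
  rw [← Finset.mul_sum, ← Finset.sum_mul] at h4
  have h5 := le_of_mul_le_mul_left (h4.trans h3) hcard
  have e5 : ∑ i with i ≠ w, t i =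
      1 / (48 * Real.log (4 / 3)) * ∑ i with i ≠ w, 1 / rowRate Δ w i := by
    rw [Finset.mul_sum]
    refine Finset.sum_congr rfl fun i _ => ?_
    simp only [ht]
    rw [one_div_mul_one_div]
  rw [e5] at h5
  have h6 := mul_le_mul_of_nonneg_left h5 (show 0 ≤ 48 * Real.log (4 / 3) * 30 by positivity)
  have e6 : 48 * Real.log (4 / 3) * 30 * (1 / (48 * Real.log (4 / 3)) *
      (∑ i with i ≠ w, 1 / rowRate Δ w i) * (11 / 30)) =
      11 * ∑ i with i ≠ w, 1 / rowRate Δ w i := by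
    field_simp
  rw [e6] at h6
  linarith

theorem log_two_le_log_inv (hδ : 0 < δ) (hδ' : δ ≤ 1 / 12) :
    Real.log 2 ≤ Real.log (1 / (6 * δ)) := by
  refine Real.log_le_log (by norm_num) ?_
  rw [le_div_iff₀ (by positivity)]
  linarith

/-- For `K > 8`, `log (2K) ≥ 4 log 2` makes the constant `2880/11` of `sum_lower_bound` small
enough. For `K ≤ 8` there are at most seven rows, and summing `row_lower_bound` suffices. -/
theorem sum_div_log_lower_bound (hδ : 0 < δ) (hδ' : δ ≤ 1 / 12) (hA : IsDeltaCorrect A δ)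
    (hΔ : IsGap Δ) (hw : IsCW Δ w) (hx : 0 ≤ x) (hN : UniformQuantileLE A Δ w δ x) :
    1 / (128 * Real.log (4 / 3)) * (1 / Real.log (2 * K)) * ∑ i with i ≠ w, 1 / rowRate Δ w i ≤
      x := by
  have hL := log_four_thirds_pos
  have hL2 : (0.6931 : ℝ) < Real.log 2 := lt_trans (by norm_num) Real.log_two_gt_d9
  have hK : 0 < K := w.pos
  have hK' : (1 : ℝ) ≤ K := by exact_mod_cast hK
  have hlog : 0 < Real.log (2 * K) := Real.log_pos (by linarith)
  rw [one_div_mul_one_div, one_div_mul_eq_div, div_le_iff₀ (by positivity)]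
  by_cases h8 : K ≤ 8
  · have hrow : ∀ i ∈ Finset.univ.filter (· ≠ w),
        1 / rowRate Δ w i ≤ 16 * Real.log (4 / 3) * x / Real.log 2 := by
      intro i hi
      have hi' := (Finset.mem_filter.1 hi).2
      have hr := rowRate_pos hw hi'
      have := row_lower_bound hδ hδ' hA hΔ hw hx hN hi'
      have h2 := log_two_le_log_inv hδ hδ'
      rw [div_le_div_iff₀ hr (by linarith)]
      linarith
    have hsum := Finset.sum_le_card_nsmul _ _ _ hrow
    rw [nsmul_eq_mul] at hsum
    have hcard : (Finset.univ.filter (· ≠ w)).card = K - 1 := by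
      rw [Finset.filter_ne', Finset.card_erase_of_mem (Finset.mem_univ w), Finset.card_univ,
        Fintype.card_fin]
    rw [hcard] at hsum
    refine hsum.trans ?_
    -- For `K = 1` the sum is empty; otherwise `log (2K) ≥ 2 log 2`.
    rcases Nat.eq_or_lt_of_le hK with h1 | h1
    · rw [← h1]
      simp only [Nat.sub_self, Nat.cast_zero, zero_mul]
      rw [h1] at *
      positivity
    have h2 : 2 * Real.log 2 ≤ Real.log (2 * K) := by
      rw [← Real.log_rpow (by norm_num)]
      refine Real.log_le_log (by norm_num) ?_
      have : (2 : ℝ) ≤ K := by exact_mod_cast h1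
      norm_num
      linarith
    have h7 : ((K - 1 : ℕ) : ℝ) ≤ 7 := by exact_mod_cast (by omega : K - 1 ≤ 7)
    have h3 : 0 ≤ 16 * Real.log (4 / 3) * x / Real.log 2 := by positivity
    calc ((K - 1 : ℕ) : ℝ) * (16 * Real.log (4 / 3) * x / Real.log 2)
        ≤ 7 * (16 * Real.log (4 / 3) * x / Real.log 2) := by gcongr
      _ ≤ x * (128 * Real.log (4 / 3) * (2 * Real.log 2)) := by
        rw [mul_div_assoc', div_le_iff₀ (by linarith)]
        have h4 : 7 ≤ 16 * (Real.log 2 * Real.log 2) := by nlinarith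
        have h5 := mul_le_mul_of_nonneg_left h4 (show 0 ≤ 16 * Real.log (4 / 3) * x by positivity)
        linarith
      _ ≤ x * (128 * Real.log (4 / 3) * Real.log (2 * K)) := by gcongr
  · have h2 : 4 * Real.log 2 ≤ Real.log (2 * K) := by
      rw [← Real.log_rpow (by norm_num)]
      refine Real.log_le_log (by norm_num) ?_
      have : (8 : ℝ) ≤ K := by exact_mod_cast (by omega : 8 ≤ K)
      norm_num
      linarith
    have := sum_lower_bound hδ hδ' hA hΔ hw hx hN
    have h3 : x * (128 * Real.log (4 / 3) * (4 * Real.log 2)) ≤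
        x * (128 * Real.log (4 / 3) * Real.log (2 * K)) := by gcongr
    have h4 : 0 ≤ x * Real.log (4 / 3) := by positivity
    nlinarith

/-- On the instance itself, ruling out the alternative for `i` at confidence `δ` takes of order `log
(1/δ) / B i` pulls of `i`, as no duel of `i` reveals more than `B i`. Only this instance enters, so
no permutations are needed. -/
theorem certify_lower_bound (hδ : 0 < δ) (hδ' : δ ≤ 1 / 12) (hA : IsDeltaCorrect A δ)
    (hM : IsGap M) (hw : IsCW M w) (hx : 0 ≤ x)
    (hN : runLaw A M {o | (x : EReal) < budget o} ≤ ENNReal.ofReal δ)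
    {B : Fin K → ℝ} (hB0 : ∀ i, i ≠ w → 0 < B i)
    (hB : ∀ i, i ≠ w → ∀ j, (min (M i j) 0) ^ 2 ≤ B i) :
    ∑ i with i ≠ w, Real.log (1 / δ) / B i ≤ 400 * x := by
  have hℓ : 2 ≤ Real.log (1 / δ) := by
    rw [Real.le_log_iff_exp_le (by positivity), le_div_iff₀ hδ]
    have e : Real.exp 2 = Real.exp 1 * Real.exp 1 := by rw [← Real.exp_add]; norm_num
    have := Real.exp_one_lt_d9
    have h0 := Real.exp_pos 1
    have h1 : Real.exp 2 ≤ 12 := by rw [e]; nlinarith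
    nlinarith
  set t : Fin K → ℝ := fun i => Real.log (1 / δ) / (40 * B i) with ht
  have ht0 : ∀ i ∈ Finset.univ.filter (· ≠ w), 0 ≤ t i := fun i hi => by
    have := hB0 i (Finset.mem_filter.1 hi).2
    positivity
  have hwin := le_winMass_of_isDeltaCorrect hδ.le hA hM hw hx hN
  have hsum := sum_mul_winMass_sub_le (A := A) (fun h p b => (envKernel_pos hM h p b).le)
    (sum_envKernel _) w (Finset.univ.filter (· ≠ w)) ht0 ⌊x⌋₊
  have hrow : ∀ i ∈ Finset.univ.filter (· ≠ w), 7 / 1200 * (Real.log (1 / δ) / B i) ≤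
      t i * (winMass A (envKernel M) w (⌊x⌋₊ + 1) 1 -
        winMass A (envKernel M) w (⌊x⌋₊ + 1) ({h | pulls i h ≤ ⌊t i⌋₊}.indicator 1)) := by
    intro i hi
    have hi' := (Finset.mem_filter.1 hi).2
    have hBi := hB0 i hi'
    -- The weight `exp c = 1/δ` on the event exactly offsets its probability `δ` under the
    -- alternative.
    have key := changeOfMeasure_swap hδ.le hA hM hi'.symm hBi.le (hB i hi') ⌊t i⌋₊ (⌊x⌋₊ + 1)
      (c := Real.log (1 / δ)) (d := 0) (by linarith)
    have e0 : (1 / δ - 1) * δ = 1 - δ := by field_simp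
    rw [Real.exp_zero, Real.exp_log (by positivity), e0] at key
    have h2 : 4 * B i * ⌊t i⌋₊ ≤ Real.log (1 / δ) / 10 := by
      calc 4 * B i * ⌊t i⌋₊ ≤ 4 * B i * t i :=
            mul_le_mul_of_nonneg_left (Nat.floor_le (ht0 i hi)) (by positivity)
        _ = Real.log (1 / δ) / 10 := by
          simp only [ht]
          field_simp
          norm_num
    set W := winMass A (envKernel M) w (⌊x⌋₊ + 1) ({h | pulls i h ≤ ⌊t i⌋₊}.indicator 1)
    -- `key` gives `log (1/δ) * W ≤ 1 - δ + log (1/δ) / 10`, and `log (1/δ) ≥ 2`. The remaining mass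
    -- is at least `5/6 - 3/5 = 7/30`.
    have h3 : W ≤ 3 / 5 := by
      by_contra hc
      push Not at hc
      nlinarith
    have e : 7 / 1200 * (Real.log (1 / δ) / B i) = t i * (7 / 30) := by
      simp only [ht]
      field_simp
      norm_num
    rw [e]
    exact mul_le_mul_of_nonneg_left (by linarith) (ht0 i hi)
  have h2 := (Finset.sum_le_sum hrow).trans hsum
  rw [← Finset.mul_sum] at h2
  linarith [Nat.floor_le hx]

end

section

/-! ### Order statistics of the negative entries -/

variable {K : ℕ} {A : Algorithm K} {Δ Δ' : Matrix (Fin K) (Fin K) ℝ} {w : Fin K} {δ x : ℝ}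

theorem getD_le_iff_lt_countP (t : ℝ) : ∀ (l : List ℝ), l.Pairwise (· ≤ ·) → ∀ r < l.length,
    (l.getD r 0 ≤ t ↔ r < l.countP fun a => a ≤ t)
  | [], _, r, hr => by simp at hr
  | a :: l, hl, r, hr => by
    rw [List.pairwise_cons] at hl
    by_cases ha : a ≤ t
    · rw [List.countP_cons_of_pos (by simpa using ha)]
      cases r with
      | zero => simpa using ha
      | succ r =>
        have := getD_le_iff_lt_countP t l hl.2 r (by simpa using hr)
        simpa using this
    · have hall : ∀ b ∈ a :: l, ¬b ≤ t := by
        intro b hb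
        rcases List.mem_cons.1 hb with rfl | hb
        · exact ha
        · exact fun h => ha ((hl.1 b hb).trans h)
      have h0 : (a :: l).countP (fun a => a ≤ t) = 0 :=
        List.countP_eq_zero.2 fun b hb => by simpa using hall b hb
      rw [h0]
      refine iff_of_false ?_ (by simp)
      rw [List.getD_eq_getElem _ _ hr]
      exact hall _ (List.getElem_mem hr)

theorem length_sort_negEntries (Δ : Matrix (Fin K) (Fin K) ℝ) (i : Fin K) :
    (((Finset.univ.filter fun j => Δ i j < 0).val.map (Δ i)).sort (· ≤ ·)).length =
      negCount Δ i := by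
  rw [Multiset.length_sort, Multiset.card_map]
  rfl

/-- Replaces the sorted list by cardinalities. Ranks start at `1` while list positions start at `0`.
-/
theorem ordGap_le_iff (Δ : Matrix (Fin K) (Fin K) ℝ) (i : Fin K) {r : ℕ} (h1 : 1 ≤ r)
    (h2 : r ≤ negCount Δ i) (t : ℝ) :
    ordGap Δ i r ≤ t ↔ r ≤ (Finset.univ.filter fun j => Δ i j < 0 ∧ Δ i j ≤ t).card := by
  have key := getD_le_iff_lt_countP t
    (((Finset.univ.filter fun j => Δ i j < 0).val.map (Δ i)).sort (· ≤ ·))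
    (Multiset.pairwise_sort _ _) (r - 1) (by rw [length_sort_negEntries]; omega)
  have e : (((Finset.univ.filter fun j => Δ i j < 0).val.map (Δ i)).sort (· ≤ ·)).countP
      (fun a => a ≤ t) = (Finset.univ.filter fun j => Δ i j < 0 ∧ Δ i j ≤ t).card := by
    rw [← Multiset.coe_countP, Multiset.sort_eq, Multiset.countP_map, ← Finset.filter_filter]
    rfl
  rw [e] at key
  rw [ordGap, key]
  omega

theorem exists_ordGap_eq (Δ : Matrix (Fin K) (Fin K) ℝ) (i : Fin K) {r : ℕ} (h1 : 1 ≤ r)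
    (h2 : r ≤ negCount Δ i) : ∃ j, Δ i j < 0 ∧ ordGap Δ i r = Δ i j := by
  have hlen : r - 1 <
      (((Finset.univ.filter fun j => Δ i j < 0).val.map (Δ i)).sort (· ≤ ·)).length := by
    rw [length_sort_negEntries]; omega
  have hmem := List.getElem_mem hlen
  rw [← List.getD_eq_getElem _ 0 hlen, Multiset.mem_sort, Multiset.mem_map] at hmem
  obtain ⟨j, hj, e⟩ := hmem
  exact ⟨j, by simpa using hj, e.symm⟩

theorem ordGap_neg (Δ : Matrix (Fin K) (Fin K) ℝ) (i : Fin K) {r : ℕ} (h1 : 1 ≤ r)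
    (h2 : r ≤ negCount Δ i) : ordGap Δ i r < 0 := by
  obtain ⟨j, hj, e⟩ := exists_ordGap_eq Δ i h1 h2
  rwa [e]

/-- There is a set of `r` positions that carry the `r` smallest entries of the row. -/
theorem exists_top_positions (Δ : Matrix (Fin K) (Fin K) ℝ) (i : Fin K) {r : ℕ} (h1 : 1 ≤ r)
    (h2 : r ≤ negCount Δ i) : ∃ S : Finset (Fin K), S.card = r ∧
      (∀ j ∈ S, Δ i j ≤ ordGap Δ i r) ∧ ∀ j ∉ S, ordGap Δ i r ≤ Δ i j := by
  classical
  have hneg := ordGap_neg Δ i h1 h2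
  set o := ordGap Δ i r with ho
  -- If more than `r` entries were below `o`, the largest of them would already bound the `r`-th
  -- smallest entry `o` from above.
  have hle : (Finset.univ.filter fun j => Δ i j < o).card ≤ r := by
    by_contra hc
    push Not at hc
    have hne : (Finset.univ.filter fun j => Δ i j < o).Nonempty := Finset.card_pos.1 (by omega)
    obtain ⟨k, hk, hmax⟩ := Finset.exists_max_image _ (Δ i) hne
    have hk' : Δ i k < o := by simpa using hk
    refine absurd ((ordGap_le_iff Δ i h1 h2 (Δ i k)).2 (hc.le.trans (Finset.card_le_card ?_)))
      (not_le.2 hk')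
    intro j hj
    have h3 := hmax j hj
    have h4 : Δ i j < o := by simpa using hj
    simp only [Finset.mem_filter, Finset.mem_univ, true_and]
    exact ⟨h4.trans hneg, h3⟩
  have hge : r ≤ (Finset.univ.filter fun j => Δ i j ≤ o).card := by
    refine ((ordGap_le_iff Δ i h1 h2 o).1 le_rfl).trans (Finset.card_le_card ?_)
    intro j hj
    simp only [Finset.mem_filter, Finset.mem_univ, true_and] at hj ⊢
    exact hj.2
  obtain ⟨S, hS1, hS2, hS3⟩ := Finset.exists_subsuperset_card_eq
    (fun j hj => by
      simp only [Finset.mem_filter, Finset.mem_univ, true_and] at hj ⊢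
      exact hj.le :
      (Finset.univ.filter fun j => Δ i j < o) ⊆ Finset.univ.filter fun j => Δ i j ≤ o) hle hge
  refine ⟨S, hS3, fun j hj => by simpa using hS2 hj, fun j hj => ?_⟩
  by_contra hc
  exact hj (hS1 (by simpa using hc))

theorem ordGap_mono (i : Fin K) (hcount : negCount Δ' i = negCount Δ i)
    (hsub : ∀ j, Δ' i j < 0 → Δ i j < 0 ∧ Δ i j ≤ Δ' i j) {r : ℕ} (h1 : 1 ≤ r)
    (h2 : r ≤ negCount Δ i) : ordGap Δ i r ≤ ordGap Δ' i r := by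
  rw [ordGap_le_iff Δ i h1 h2]
  refine ((ordGap_le_iff Δ' i h1 (hcount ▸ h2) _).1 le_rfl).trans (Finset.card_le_card ?_)
  intro j hj
  simp only [Finset.mem_filter, Finset.mem_univ, true_and] at hj ⊢
  exact ⟨(hsub j hj.1).1, (hsub j hj.1).2.trans hj.2⟩

/-! ### Effective sparsity of dominated instances -/

/-- Shrinking the negative gaps can only raise the objective at a competitor, while its value at `s`
is unchanged; equal counts keep the admissible vectors the same. -/
theorem isEffectiveSparsity_of_dominated {m : ℕ} {s : Fin K → ℕ} (hδ : 0 < δ) (hδ' : δ ≤ 1)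
    (hs : IsEffectiveSparsity m Δ w δ s)
    (hcount : ∀ i, i ≠ w → negCount Δ' i = negCount Δ i)
    (hle : ∀ i, i ≠ w → ∀ r, 1 ≤ r → r ≤ negCount Δ i → ordGap Δ i r ≤ ordGap Δ' i r)
    (heq : ∀ i, i ≠ w → ordGap Δ' i (s i) = ordGap Δ i (s i)) :
    IsEffectiveSparsity m Δ' w δ s := by
  have hadm : ∀ s', IsAdmissible m Δ' w s' ↔ IsAdmissible m Δ w s' := fun s' =>
    forall₂_congr fun i hi => by rw [hcount i hi]
  refine ⟨(hadm s).2 hs.1, fun s' hs' => ?_⟩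
  have hs'' := (hadm s').1 hs'
  have hℓ : 0 ≤ Real.log (1 / δ) := Real.log_nonneg (by rw [le_div_iff₀ hδ]; linarith)
  have e1 : Hcertify Δ' w δ s = Hcertify Δ w δ s :=
    Finset.sum_congr rfl fun i hi => by rw [heq i (Finset.mem_filter.1 hi).2]
  have e2 : Hexplore Δ' w δ s = Hexplore Δ w δ s := by
    unfold Hexplore
    congr 1
    · exact iSup_congr fun i => by rw [heq i.1 i.2]
    · exact Finset.sum_congr rfl fun i hi => by rw [heq i (Finset.mem_filter.1 hi).2]
  have hsq : ∀ i, i ≠ w →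
      0 < (ordGap Δ' i (s' i)) ^ 2 ∧ (ordGap Δ' i (s' i)) ^ 2 ≤ (ordGap Δ i (s' i)) ^ 2 := by
    intro i hi
    have h1 := hs'' i hi
    have h2 := ordGap_neg Δ' i h1.1 (hcount i hi ▸ h1.2.1)
    have h3 := hle i hi _ h1.1 h1.2.1
    exact ⟨sq_pos_of_neg h2, by nlinarith⟩
  have h3 : Hcertify Δ w δ s' ≤ Hcertify Δ' w δ s' := by
    refine Finset.sum_le_sum fun i hi => ?_
    have := hsq i (Finset.mem_filter.1 hi).2
    exact div_le_div_of_nonneg_left hℓ this.1 this.2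
  have h4 : Hexplore Δ w δ s' ≤ Hexplore Δ' w δ s' := by
    have hspos : ∀ i, i ≠ w → (0 : ℝ) < s' i := fun i hi => by
      exact_mod_cast (hs'' i hi).1
    refine add_le_add ?_ (Finset.sum_le_sum fun i hi => ?_)
    · refine ciSup_mono (Set.finite_range _).bddAbove fun i => ?_
      have := hsq i.1 i.2
      have h5 := hspos i.1 i.2
      exact div_le_div_of_nonneg_left (by positivity) (mul_pos h5 this.1)
        (mul_le_mul_of_nonneg_left this.2 h5.le)
    · have hi' := (Finset.mem_filter.1 hi).2
      have := hsq i hi'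
      have h5 := hspos i hi'
      exact div_le_div_of_nonneg_left (by positivity) (mul_pos h5 this.1)
        (mul_le_mul_of_nonneg_left this.2 h5.le)
  rw [e1, e2]
  exact (hs.2 s' hs'').trans (add_le_add h3 h4)

/-! ### The sparsified instance -/

/-- In each row, the entry of the winner is kept, the other negative entries at the positions
of `S` are set to `o`, and the remaining ones are divided by `K`. -/
noncomputable def sparseEntry {K : ℕ} (Δ : Matrix (Fin K) (Fin K) ℝ) (w : Fin K) (o : Fin K → ℝ)
    (S : Fin K → Finset (Fin K)) (i j : Fin K) : ℝ :=
  if j = w then Δ i w else if j ∈ S i then o i else Δ i j / K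

/-- The skew-symmetric matrix whose negative entries are given by `sparseEntry`. -/
noncomputable def sparsified {K : ℕ} (Δ : Matrix (Fin K) (Fin K) ℝ) (w : Fin K) (o : Fin K → ℝ)
    (S : Fin K → Finset (Fin K)) : Matrix (Fin K) (Fin K) ℝ := fun i j =>
  if Δ i j < 0 then sparseEntry Δ w o S i j
  else if Δ j i < 0 then -sparseEntry Δ w o S j i else 0

/-- `S i` carries the smallest entries of row `i`, and `o i` is the threshold. -/
structure IsTop {K : ℕ} (Δ : Matrix (Fin K) (Fin K) ℝ) (w : Fin K) (o : Fin K → ℝ)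
    (S : Fin K → Finset (Fin K)) : Prop where
  neg : ∀ i, i ≠ w → o i < 0
  le : ∀ i, i ≠ w → ∀ j ∈ S i, Δ i j ≤ o i
  ge : ∀ i, i ≠ w → ∀ j ∉ S i, o i ≤ Δ i j

variable {o : Fin K → ℝ} {S : Fin K → Finset (Fin K)}

theorem ne_winner_of_neg (hw : IsCW Δ w) (hΔ : IsGap Δ) {i j : Fin K} (h : Δ i j < 0) : i ≠ w := by
  rintro rfl
  by_cases hj : j = i
  · rw [hj, hΔ.diag] at h
    exact lt_irrefl _ h
  · linarith [hw j hj]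

/-- Strict negativity, the reason for dividing by `K` instead of erasing, preserves `K_{i;<0}`; the
second part is the domination used for the effective sparsity. -/
theorem sparseEntry_mem (hΔ : IsGap Δ) (hw : IsCW Δ w) (hS : IsTop Δ w o S) {i j : Fin K}
    (h : Δ i j < 0) : sparseEntry Δ w o S i j < 0 ∧ Δ i j ≤ sparseEntry Δ w o S i j := by
  have hi := ne_winner_of_neg hw hΔ h
  have hK : (1 : ℝ) ≤ K := by exact_mod_cast w.pos
  unfold sparseEntry
  split_ifs with h1 h2
  · subst h1
    exact ⟨h, le_rfl⟩
  · exact ⟨hS.neg i hi, hS.le i hi j h2⟩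
  · refine ⟨div_neg_of_neg_of_pos h (by linarith), ?_⟩
    rw [le_div_iff₀ (by linarith)]
    nlinarith

theorem sparsified_of_neg {i j : Fin K} (h : Δ i j < 0) :
    sparsified Δ w o S i j = sparseEntry Δ w o S i j := by
  simp [sparsified, h]

theorem sparsified_neg_iff (hΔ : IsGap Δ) (hw : IsCW Δ w) (hS : IsTop Δ w o S) (i j : Fin K) :
    sparsified Δ w o S i j < 0 ↔ Δ i j < 0 := by
  unfold sparsified
  split_ifs with h1 h2
  · simp [h1, (sparseEntry_mem hΔ hw hS h1).1]
  · have := (sparseEntry_mem hΔ hw hS h2).1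
    constructor <;> intro <;> linarith
  · simp [h1]

theorem isGap_sparsified (hΔ : IsGap Δ) (hw : IsCW Δ w) (hS : IsTop Δ w o S) :
    IsGap (sparsified Δ w o S) := by
  have hmem : ∀ i j, Δ i j < 0 → sparseEntry Δ w o S i j ∈ Set.Icc (-(1 / 4) : ℝ) 0 :=
    fun i j h => ⟨(hΔ.1 i j).1.trans (sparseEntry_mem hΔ hw hS h).2,
      (sparseEntry_mem hΔ hw hS h).1.le⟩
  constructor
  · intro i j
    unfold sparsified
    split_ifs with h1 h2
    · exact ⟨(hmem i j h1).1, by linarith [(hmem i j h1).2]⟩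
    · exact ⟨by linarith [(hmem j i h2).2], by linarith [(hmem j i h2).1]⟩
    · norm_num
  · intro i j
    unfold sparsified
    have := hΔ.2 i j
    by_cases h1 : Δ i j < 0
    · have h2 : ¬Δ j i < 0 := by linarith
      simp [h1, h2]
    · by_cases h2 : Δ j i < 0 <;> simp [h1, h2]

theorem sparsified_winner (hΔ : IsGap Δ) (hw : IsCW Δ w) {i : Fin K} (hi : i ≠ w) :
    sparsified Δ w o S w i = Δ w i := by
  have h1 : ¬Δ w i < 0 := by linarith [hw i hi]
  have h2 : Δ i w < 0 := by rw [hΔ.2 w i]; linarith [hw i hi]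
  rw [sparsified, if_neg h1, if_pos h2, sparseEntry, if_pos rfl, hΔ.2 w i, neg_neg]

theorem isCW_sparsified (hΔ : IsGap Δ) (hw : IsCW Δ w) : IsCW (sparsified Δ w o S) w :=
  fun j hj => by
    rw [sparsified_winner hΔ hw hj]
    exact hw j hj

theorem negCount_sparsified (hΔ : IsGap Δ) (hw : IsCW Δ w) (hS : IsTop Δ w o S) (i : Fin K) :
    negCount (sparsified Δ w o S) i = negCount Δ i := by
  unfold negCount
  congr 1
  exact Finset.filter_congr fun j _ => sparsified_neg_iff hΔ hw hS i j

theorem ordGap_le_ordGap_sparsified (hΔ : IsGap Δ) (hw : IsCW Δ w) (hS : IsTop Δ w o S)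
    (i : Fin K) {r : ℕ} (h1 : 1 ≤ r) (h2 : r ≤ negCount Δ i) :
    ordGap Δ i r ≤ ordGap (sparsified Δ w o S) i r := by
  refine ordGap_mono i (negCount_sparsified hΔ hw hS i) (fun j hj => ?_) h1 h2
  have h3 := (sparsified_neg_iff hΔ hw hS i j).1 hj
  rw [sparsified_of_neg h3]
  exact ⟨h3, (sparseEntry_mem hΔ hw hS h3).2⟩

theorem ordGap_sparsified (hΔ : IsGap Δ) (hw : IsCW Δ w) (hS : IsTop Δ w o S) {i : Fin K}
    (hi : i ≠ w) (h1 : 1 ≤ (S i).card) (h2 : (S i).card ≤ negCount Δ i)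
    (ho : o i = ordGap Δ i (S i).card) :
    ordGap (sparsified Δ w o S) i (S i).card = ordGap Δ i (S i).card := by
  refine le_antisymm ?_ (ordGap_le_ordGap_sparsified hΔ hw hS i h1 h2)
  rw [ordGap_le_iff _ i h1 (by rwa [negCount_sparsified hΔ hw hS]), ← ho]
  refine Finset.card_le_card fun j hj => ?_
  have hle := hS.le i hi j hj
  have hneg : Δ i j < 0 := hle.trans_lt (hS.neg i hi)
  simp only [Finset.mem_filter, Finset.mem_univ, true_and]
  refine ⟨(sparsified_neg_iff hΔ hw hS i j).2 hneg, ?_⟩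
  rw [sparsified_of_neg hneg, sparseEntry]
  -- If `w` itself is a top position, its entry is kept rather than flattened, but it already lies
  -- below `o i`.
  split_ifs with h3
  · rwa [← h3]
  · exact le_rfl

theorem min_sparsified_sq_le (hΔ : IsGap Δ) (hw : IsCW Δ w) (hS : IsTop Δ w o S) {i : Fin K}
    (hi : i ≠ w) (j : Fin K) :
    (min (sparsified Δ w o S i j) 0) ^ 2 ≤
      (if j = w then (Δ w i) ^ 2 else 0) + ((if j ∈ S i then (o i) ^ 2 else 0) + (o i) ^ 2 / K) := by
  have hK : (1 : ℝ) ≤ K := by exact_mod_cast w.pos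
  have h0 : 0 ≤ (o i) ^ 2 / K := by positivity
  have h1 : (0 : ℝ) ≤ if j ∈ S i then (o i) ^ 2 else 0 := by split_ifs <;> positivity
  have h2 : (0 : ℝ) ≤ if j = w then (Δ w i) ^ 2 else 0 := by split_ifs <;> positivity
  by_cases hj : Δ i j < 0
  · rw [min_eq_left ((sparsified_neg_iff hΔ hw hS i j).2 hj).le, sparsified_of_neg hj, sparseEntry]
    by_cases hjw : j = w
    · simp only [hjw, if_true] at h1 ⊢
      rw [hΔ.2 w i, neg_sq]
      linarith
    · by_cases hjS : j ∈ S i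
      · simp only [hjw, hjS, if_true, if_false] at h2 ⊢
        linarith
      · simp only [hjw, hjS, if_false, zero_add]
        have h3 := hS.ge i hi j hjS
        rw [div_pow]
        have h4 : (Δ i j) ^ 2 ≤ (o i) ^ 2 := by nlinarith
        exact div_le_div₀ (sq_nonneg _) h4 (by linarith) (by nlinarith)
  · rw [min_eq_right (not_lt.1 fun h => hj ((sparsified_neg_iff hΔ hw hS i j).1 h))]
    norm_num
    positivity

theorem min_sparsified_sq_le_max (hΔ : IsGap Δ) (hw : IsCW Δ w) (hS : IsTop Δ w o S) {i : Fin K}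
    (hi : i ≠ w) (j : Fin K) :
    (min (sparsified Δ w o S i j) 0) ^ 2 ≤ max ((Δ w i) ^ 2) ((o i) ^ 2) := by
  have hK : (1 : ℝ) ≤ K := by exact_mod_cast w.pos
  by_cases hj : Δ i j < 0
  · rw [min_eq_left ((sparsified_neg_iff hΔ hw hS i j).2 hj).le, sparsified_of_neg hj, sparseEntry]
    split_ifs with hjw hjS
    · rw [hΔ.2 w i, neg_sq]
      exact le_max_left _ _
    · exact le_max_right _ _
    · have h3 := hS.ge i hi j hjS
      have h4 : (Δ i j) ^ 2 ≤ (o i) ^ 2 := by nlinarith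
      refine le_trans ?_ (le_max_right _ _)
      rw [div_pow]
      exact (div_le_self (sq_nonneg _) (by nlinarith)).trans h4
  · rw [min_eq_right (not_lt.1 fun h => hj ((sparsified_neg_iff hΔ hw hS i j).1 h))]
    norm_num
    exact Or.inl (sq_nonneg _)

/-- The entries off `S i` are at most `|o i| / K` in size, so together they add at most `(o i)²`,
which is absorbed by the top block since `S i` is nonempty. -/
theorem rowRate_sparsified_le (hΔ : IsGap Δ) (hw : IsCW Δ w) (hS : IsTop Δ w o S) {i : Fin K}
    (hi : i ≠ w) (h1 : 1 ≤ (S i).card) :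
    rowRate (sparsified Δ w o S) w i ≤
      3 * max ((Δ w i) ^ 2) ((S i).card * (o i) ^ 2 / negCount Δ i) := by
  have hK : (0 : ℝ) < K := by exact_mod_cast w.pos
  have hc : (1 : ℝ) ≤ negCount Δ i := by exact_mod_cast negCount_pos hΔ hw hi
  have hsum : negNormSq (sparsified Δ w o S) i ≤ (Δ w i) ^ 2 + 2 * ((S i).card * (o i) ^ 2) := by
    refine (Finset.sum_le_sum fun j _ => min_sparsified_sq_le hΔ hw hS hi j).trans ?_
    rw [Finset.sum_add_distrib, Finset.sum_add_distrib, Finset.sum_ite_eq' Finset.univ w,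
      Finset.sum_const, Finset.sum_ite_mem, Finset.sum_const, Finset.card_univ, Fintype.card_fin,
      Finset.univ_inter]
    simp only [Finset.mem_univ, if_true, nsmul_eq_mul]
    rw [mul_div_cancel₀ _ hK.ne']
    have h2 : (1 : ℝ) ≤ (S i).card := by exact_mod_cast h1
    nlinarith [sq_nonneg (o i)]
  have hA := le_max_left ((Δ w i) ^ 2) ((S i).card * (o i) ^ 2 / negCount Δ i)
  have hB := le_max_right ((Δ w i) ^ 2) ((S i).card * (o i) ^ 2 / negCount Δ i)
  have hpos : 0 ≤ (Δ w i) ^ 2 := sq_nonneg _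
  rw [rowRate, sparsified_winner hΔ hw hi, negCount_sparsified hΔ hw hS]
  refine max_le (by linarith) ?_
  calc negNormSq (sparsified Δ w o S) i / negCount Δ i
      ≤ ((Δ w i) ^ 2 + 2 * ((S i).card * (o i) ^ 2)) / negCount Δ i := by gcongr
    _ = (Δ w i) ^ 2 / negCount Δ i + 2 * ((S i).card * (o i) ^ 2 / negCount Δ i) := by ring
    _ ≤ (Δ w i) ^ 2 + 2 * ((S i).card * (o i) ^ 2 / negCount Δ i) := by
        gcongr
        exact div_le_self hpos hc
    _ ≤ _ := by linarith

theorem permuted_one (hΔ : IsGap Δ) : permuted Δ 1 = Δ := by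
  ext i j
  rcases lt_trichotomy (Δ i j) 0 with h | h | h
  · rw [permuted_of_neg 1 h]; rfl
  · rw [permuted_of_zero hΔ 1 h, h]
  · have h2 : Δ j i < 0 := by rw [hΔ.2 i j]; linarith
    rw [permuted_of_neg_swap hΔ 1 h2, hΔ.2 j i]; rfl

/-! ### The main bounds -/

theorem iSup_lower_bound (hδ : 0 < δ) (hδ' : δ ≤ 1 / 12) (hA : IsDeltaCorrect A δ)
    (hΔ : IsGap Δ) (hw : IsCW Δ w) (hx : 0 ≤ x) (hN : UniformQuantileLE A Δ w δ x) :
    1 / (16 * Real.log (4 / 3)) * (⨆ i : {i : Fin K // i ≠ w},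
      min (1 / (Δ w i) ^ 2) ((negCount Δ i : ℝ) / negNormSq Δ i)) * Real.log (1 / (6 * δ)) ≤ x := by
  have hL := log_four_thirds_pos
  have hℓ : 0 < Real.log (1 / (6 * δ)) :=
    (Real.log_pos (by norm_num)).trans_le (log_two_le_log_inv hδ hδ')
  have hsup : (⨆ i : {i : Fin K // i ≠ w},
      min (1 / (Δ w i) ^ 2) ((negCount Δ i : ℝ) / negNormSq Δ i)) ≤
      16 * Real.log (4 / 3) * x / Real.log (1 / (6 * δ)) := by
    -- The nonnegativity goal covers `K = 1`, where the supremum over the empty type is `0`.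
    refine Real.iSup_le (fun i => ?_) (by positivity)
    rw [min_inv_eq_inv_rowRate hΔ hw i.2, div_le_div_iff₀ (rowRate_pos hw i.2) hℓ]
    linarith [row_lower_bound hδ hδ' hA hΔ hw hx hN i.2]
  calc _ ≤ 1 / (16 * Real.log (4 / 3)) * (16 * Real.log (4 / 3) * x / Real.log (1 / (6 * δ))) *
        Real.log (1 / (6 * δ)) := by gcongr
    _ = x := by field_simp

theorem le_chiTilde {y : ℝ} (h : ∀ x, 0 ≤ x → UniformQuantileLE A Δ w δ x → y ≤ x) :
    (y : EReal) ≤ chiTilde A Δ w δ := by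
  refine le_sInf ?_
  rintro _ ⟨x, ⟨hx, hsup⟩, rfl⟩
  refine EReal.coe_le_coe_iff.2 (h x hx.le fun π hπ => le_trans ?_ hsup)
  exact le_iSup (fun π : {π : RowPerms Δ // FixesWinner w π} =>
    runLaw A (permuted Δ π.1) {o | (x : EReal) < budget o}) ⟨π, hπ⟩

/-- Equivalent to `6⁴ δ³ ≤ 1`, which holds for `δ ≤ 1/12`. -/
theorem log_inv_le (hδ : 0 < δ) (hδ' : δ ≤ 1 / 12) :
    Real.log (1 / δ) ≤ 4 * Real.log (1 / (6 * δ)) := by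
  rw [← Real.log_rpow (by positivity)]
  refine Real.log_le_log (by positivity) ?_
  have e : (1 / (6 * δ)) ^ (4 : ℝ) = 1 / (6 * δ) ^ 4 := by
    rw [← one_div_pow]
    exact_mod_cast Real.rpow_natCast (1 / (6 * δ)) 4
  rw [e]
  refine one_div_le_one_div_of_le (by positivity) ?_
  have h3 : δ ^ 3 ≤ (1 / 12) ^ 3 := by gcongr
  nlinarith

/-- The factor `600` exceeds the sum `400 + 64 + 128` of the constants obtained for the three terms.
The case `y ≤ 0` is separate because it admits no strict inequality when all sums are empty. -/
theorem exists_mem_classD0 {m : ℕ} {s : Fin K → ℕ} (hδ : 0 < δ) (hδ' : δ ≤ 1 / 12)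
    (hA : IsDeltaCorrect A δ) (hΔ : IsGap Δ) (hw : IsCW Δ w)
    (hs : IsEffectiveSparsity m Δ w δ s) {y : ℝ}
    (hy : 600 * y < (∑ i with i ≠ w,
          Real.log (1 / δ) / max ((Δ w i) ^ 2) ((ordGap Δ i (s i)) ^ 2)) +
        (⨆ i : {i : Fin K // i ≠ w},
          Real.log (1 / δ) / max ((Δ w i) ^ 2) ((s i : ℝ) * (ordGap Δ i (s i)) ^ 2 / negCount Δ i)) +
        1 / Real.log (2 * K) * ∑ i with i ≠ w,
          1 / max ((Δ w i) ^ 2) ((s i : ℝ) * (ordGap Δ i (s i)) ^ 2 / negCount Δ i) ∨ y ≤ 0) :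
    ∃ Δ' ∈ classD0 m Δ w δ s,
      ENNReal.ofReal δ ≤ runLaw A Δ' {o | (y : EReal) ≤ budget o} := by
  classical
  have hS0 : ∀ i, ∃ T : Finset (Fin K), i ≠ w → T.card = s i ∧
      (∀ j ∈ T, Δ i j ≤ ordGap Δ i (s i)) ∧ ∀ j ∉ T, ordGap Δ i (s i) ≤ Δ i j := by
    intro i
    by_cases hi : i = w
    · exact ⟨∅, fun h => absurd hi h⟩
    · obtain ⟨T, hT⟩ := exists_top_positions Δ i (hs.1 i hi).1 (hs.1 i hi).2.1
      exact ⟨T, fun _ => hT⟩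
  choose S hS1 using hS0
  set o : Fin K → ℝ := fun i => ordGap Δ i (s i) with ho
  have hS : IsTop Δ w o S :=
    ⟨fun i hi => ordGap_neg Δ i (hs.1 i hi).1 (hs.1 i hi).2.1, fun i hi => (hS1 i hi).2.1,
      fun i hi => (hS1 i hi).2.2⟩
  set Γ := sparsified Δ w o S with hΓ
  have hg : IsGap Γ := isGap_sparsified hΔ hw hS
  have hcw : IsCW Γ w := isCW_sparsified hΔ hw
  have heq : ∀ i, i ≠ w → ordGap Γ i (s i) = ordGap Δ i (s i) := by
    intro i hi
    have h1 := hs.1 i hi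
    have h2 := (hS1 i hi).1
    rw [← h2] at h1 ⊢
    exact ordGap_sparsified hΔ hw hS hi h1.1 h1.2.1 (by rw [ho, h2])
  have hclass : ∀ π : RowPerms Γ, FixesWinner w π → permuted Γ π ∈ classD0 m Δ w δ s := by
    intro π hπ
    have hcwπ := isCW_permuted hg hcw hπ
    have heqπ : ∀ i, i ≠ w → ordGap (permuted Γ π) i (s i) = ordGap Δ i (s i) := fun i hi => by
      rw [ordGap_permuted hg, heq i hi]
    refine ⟨⟨mem_Dcw_of_isGap (isGap_permuted hg π) hcwπ, hcwπ, ?_, heqπ⟩, fun i hi => ?_⟩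
    · refine isEffectiveSparsity_of_dominated hδ (by linarith) hs (fun i _ => ?_)
        (fun i _ r h1 h2 => ?_) heqπ
      · rw [negCount_permuted hg, negCount_sparsified hΔ hw hS]
      · rw [ordGap_permuted hg]
        exact ordGap_le_ordGap_sparsified hΔ hw hS i h1 h2
    · exact (permuted_winner hg hcw hπ hi).trans (sparsified_winner hΔ hw hi)
  have hone : FixesWinner w (1 : RowPerms Γ) := fun _ _ => rfl
  rcases le_or_gt y 0 with hy0 | hy0
  · refine ⟨_, hclass 1 hone, ?_⟩
    have huniv : {o : RunResult K | (y : EReal) ≤ budget o} = Set.univ := by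
      refine Set.eq_univ_of_forall fun o => ?_
      have h1 : (y : EReal) ≤ 0 := by exact_mod_cast hy0
      refine h1.trans ?_
      rcases o with _ | ⟨h, k⟩
      · exact le_top
      · change (0 : EReal) ≤ ((h.length : ℕ) : EReal)
        exact_mod_cast Nat.zero_le _
    rw [huniv, MeasureTheory.measure_univ]
    exact ENNReal.ofReal_le_one.2 (by linarith)
  by_contra hcon
  push Not at hcon
  -- If the claim failed throughout the class, it would fail on every permuted copy of `Γ`, so `y`
  -- would be a uniform quantile for `Γ` and all the lower bounds would apply with `x = y`.
  have hN : UniformQuantileLE A Γ w δ y := fun π hπ =>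
    (MeasureTheory.measure_mono fun _ (h : (y : EReal) < _) => h.le).trans
      (hcon _ (hclass π hπ)).le
  have hL := log_four_thirds_pos
  have hL3 : Real.log (4 / 3) ≤ 1 / 3 := by
    have := Real.log_le_sub_one_of_pos (x := (4 / 3 : ℝ)) (by norm_num)
    linarith
  have hℓ : 0 ≤ Real.log (1 / δ) := Real.log_nonneg (by rw [le_div_iff₀ hδ]; linarith)
  have hwpos : ∀ i, i ≠ w → 0 < (Δ w i) ^ 2 := fun i hi => pow_pos (hw i hi) 2
  set R : Fin K → ℝ := fun i =>
    max ((Δ w i) ^ 2) ((s i : ℝ) * (ordGap Δ i (s i)) ^ 2 / negCount Δ i) with hR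
  have hRpos : ∀ i, i ≠ w → 0 < R i := fun i hi => lt_max_of_lt_left (hwpos i hi)
  have hrate : ∀ i, i ≠ w → rowRate Γ w i ≤ 3 * R i := by
    intro i hi
    have h2 := (hS1 i hi).1
    have := rowRate_sparsified_le hΔ hw hS hi (by rw [h2]; exact (hs.1 i hi).1)
    rwa [h2] at this
  have hT1 : ∑ i with i ≠ w,
      Real.log (1 / δ) / max ((Δ w i) ^ 2) ((ordGap Δ i (s i)) ^ 2) ≤ 400 * y := by
    have h1 := hN 1 hone
    rw [permuted_one hg] at h1
    exact certify_lower_bound hδ hδ' hA hg hcw hy0.le h1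
      (fun i hi => lt_max_of_lt_left (hwpos i hi))
      (fun i hi => min_sparsified_sq_le_max hΔ hw hS hi)
  have hT2 : (⨆ i : {i : Fin K // i ≠ w}, Real.log (1 / δ) / R i) ≤ 64 * y := by
    refine Real.iSup_le (fun i => ?_) (by positivity)
    rw [div_le_iff₀ (hRpos i.1 i.2)]
    have h1 := row_lower_bound hδ hδ' hA hg hcw hy0.le hN i.2
    have h2 := log_inv_le hδ hδ'
    have h3 : 16 * Real.log (4 / 3) * rowRate Γ w i * y ≤ 16 * (1 / 3) * (3 * R i) * y := by
      have := hrate i.1 i.2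
      have := (rowRate_pos hcw i.2).le
      gcongr
    linarith
  have hT3 : 1 / Real.log (2 * K) * ∑ i with i ≠ w, 1 / R i ≤ 128 * y := by
    have hK' : (1 : ℝ) ≤ K := by exact_mod_cast w.pos
    have hlog : 0 < Real.log (2 * K) := Real.log_pos (by linarith)
    have h1 := sum_div_log_lower_bound hδ hδ' hA hg hcw hy0.le hN
    have h2 : ∑ i with i ≠ w, 1 / R i ≤ 3 * ∑ i with i ≠ w, 1 / rowRate Γ w i := by
      rw [Finset.mul_sum]
      refine Finset.sum_le_sum fun i hi => ?_
      have hi' := (Finset.mem_filter.1 hi).2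
      rw [mul_one_div, div_le_div_iff₀ (hRpos i hi') (rowRate_pos hcw hi')]
      linarith [hrate i hi']
    calc 1 / Real.log (2 * K) * ∑ i with i ≠ w, 1 / R i
        ≤ 1 / Real.log (2 * K) * (3 * ∑ i with i ≠ w, 1 / rowRate Γ w i) := by gcongr
      _ = 384 * Real.log (4 / 3) * (1 / (128 * Real.log (4 / 3)) * (1 / Real.log (2 * K)) *
            ∑ i with i ≠ w, 1 / rowRate Γ w i) := by
          field_simp
          ring
      _ ≤ 384 * Real.log (4 / 3) * y := by gcongr
      _ ≤ 384 * (1 / 3) * y := by gcongr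
      _ = 128 * y := by norm_num
  rcases hy with hy | hy
  · linarith
  · linarith

end

end Dueling

theorem mainTheorem9 :
    (∀ (K : ℕ) (δ : ℝ), 0 < δ → δ ≤ 1 / 12 →
      ∀ A : Dueling.Algorithm K, Dueling.IsDeltaCorrect A δ →
      ∀ Δ ∈ Dueling.Dcw K, ∀ w : Fin K, Dueling.IsCW Δ w →
        ((1 / (16 * Real.log (4 / 3)) *
            (⨆ i : {i : Fin K // i ≠ w},
              min (1 / (Δ w i) ^ 2) ((Dueling.negCount Δ i : ℝ) / Dueling.negNormSq Δ i)) *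
            Real.log (1 / (6 * δ)) : ℝ) : EReal) ≤ Dueling.chiTilde A Δ w δ ∧
        ((1 / (128 * Real.log (4 / 3)) * (1 / Real.log (2 * K)) *
            (∑ i with i ≠ w,
              min (1 / (Δ w i) ^ 2) ((Dueling.negCount Δ i : ℝ) / Dueling.negNormSq Δ i)) : ℝ) :
            EReal) ≤ Dueling.chiTilde A Δ w δ) ∧
    (∃ c : ℝ, 0 < c ∧
      ∀ (K m : ℕ) (δ : ℝ), 0 < δ → δ ≤ 1 / 12 →
      ∀ A : Dueling.Algorithm K, Dueling.IsDeltaCorrect A δ →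
      ∀ Δ ∈ Dueling.Dcw K, ∀ w : Fin K, Dueling.IsCW Δ w →
      ∀ s : Fin K → ℕ, Dueling.IsEffectiveSparsity m Δ w δ s →
        ∃ Δ' ∈ Dueling.classD0 m Δ w δ s,
          ENNReal.ofReal δ ≤ Dueling.runLaw A Δ'
            {o | ((c * ((∑ i with i ≠ w,
                    Real.log (1 / δ) / max ((Δ w i) ^ 2) ((Dueling.ordGap Δ i (s i)) ^ 2)) +
                  (⨆ i : {i : Fin K // i ≠ w},
                    Real.log (1 / δ) / max ((Δ w i) ^ 2)
                      ((s i : ℝ) * (Dueling.ordGap Δ i (s i)) ^ 2 / Dueling.negCount Δ i)) +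
                  1 / Real.log (2 * K) *
                    ∑ i with i ≠ w,
                      1 / max ((Δ w i) ^ 2)
                        ((s i : ℝ) * (Dueling.ordGap Δ i (s i)) ^ 2 /
                          Dueling.negCount Δ i)) : ℝ) : EReal) ≤ Dueling.budget o}) := by
  refine ⟨fun K δ hδ hδ' A hA Δ hΔ w hw => ?_, 1 / 1000, by norm_num,
    fun K m δ hδ hδ' A hA Δ hΔ w hw s hs => ?_⟩
  · have hg := Dueling.isGap_of_mem_Dcw hΔ
    refine ⟨Dueling.le_chiTilde fun x hx hN =>
      Dueling.iSup_lower_bound hδ hδ' hA hg hw hx hN, Dueling.le_chiTilde fun x hx hN => ?_⟩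
    rw [Finset.sum_congr rfl fun i hi =>
      Dueling.min_inv_eq_inv_rowRate hg hw (Finset.mem_filter.1 hi).2]
    exact Dueling.sum_div_log_lower_bound hδ hδ' hA hg hw hx hN
  · refine Dueling.exists_mem_classD0 hδ hδ' hA (Dueling.isGap_of_mem_Dcw hΔ) hw hs ?_
    -- With `y` equal to the bracket divided by `1000`, either `y ≤ 0` or `600 * y` is strictly
    -- below the bracket.
    by_contra! hc
    linarith [hc.1, hc.2]
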